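/- Let $M$ be a connected closed hyperbolic 3-manifold tessellated by finitely many regular right-angled hyperbolic dodecahedra $D_i$, $i\in I$: that is, $M$ is obtained from $\bigsqcup_i D_i$ by gluing the pentagonal faces in pairs by isometries, and the result is a hyperbolic 3-manifold. Construction of $W$. For each $i\in I$ take a regular right-angled hyperbolic 120-cell $H_i$ and identify $D_i$ with one of its facets. Whenever a face $F$ of $D_i$ is glued to a face $G$ of $D_j$, extend this gluing to the gluing $\mathcal A\to\mathcal B$ of the facets $\mathcal A\neq D_i$ of $H_i$ and $\mathcal B\neq D_j$ of $H_j$ with $D_i\cap\mathcal A=F$ and $D_j\cap\mathcal B=G$. This gives a hyperbolic 4-manifold with right-angled corners $W'$, in which $M$ is an isolated facet. Let $W$ be the mirror of $W'$ along $M$, i.e. two copies $W'_+$, $W'_-$ of $W'$ glued along $M$. The set $\mathcal F_W$ of facets of $W$ is $(\mathcal F_{W'_+}\setminus\{M\})\sqcup(\mathcal F_{W'_-}\setminus\{M\})$; let $s$ be the involution of $\mathcal F_W$ that exchanges corresponding facets of the two copies. Colouring. A $k$-colouring of $W$ is a surjective map $\lambda:\mathcal F_W\to\{1,\dots,k\}$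 that takes distinct values on adjacent facets (a non-embedded facet counts as adjacent to itself); it is symmetric if $\lambda\circ s=\lambda$. Let $e_1,\dots,e_k$ be the canonical basis of $\mathbb Z_2^k$ and let $N=(W\times\mathbb Z_2^k)/\!\sim$, where $W\times\{u\}$ and $W\times\{v\}$ are glued along the identity of a facet $F$ whenever $u-v=e_{\lambda(F)}$; this is a hyperbolic 4-manifold. Statement. Let $N$ be obtained from a symmetric $k$-colouring of $W$. Then the inclusion $M\subset W$ induces a map $M\times\mathbb Z_2^k\to N$ which is a totally geodesic embedding: it is a topological embedding, and around each point there are hyperbolic charts of $M\times\mathbb Z_2^k$ and of $N$ in which it is the inclusion of a totally geodesic hyperplane $\mathbb H^3\subset\mathbb H^4$, the image of the embedding being the slice $\mathbb H^3$ of the chart. Moreover, the complement in $N$ of the image is the disjoint union of two connected (non-empty) open subsets $N_+$ and $N_-$, which are isometric with respect to their intrinsic path metrics. -/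

import Mathlib

open Topology
open scoped goldenRatio

noncomputable section

namespace Dodecahedral

/-! ### Hyperbolic space (hyperboloid model) and right-angled polytopes -/

/-- Hyperbolic `n`-space: the upper sheet `|x|² - t² = -1`, `t > 0` of the hyperboloid, with the
topology of the ambient space. -/
def Hyp (n : ℕ) : Type :=
  {p : (Fin n → ℝ) × ℝ // p.1 ⬝ᵥ p.1 - p.2 ^ 2 = -1 ∧ 0 < p.2}

instance (n : ℕ) : TopologicalSpace (Hyp n) :=
  inferInstanceAs (TopologicalSpace {p : (Fin n → ℝ) × ℝ // p.1 ⬝ᵥ p.1 - p.2 ^ 2 = -1 ∧ 0 < p.2})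

/-- Spatial coordinates of a point of the hyperboloid. -/
def Hyp.space {n : ℕ} (p : Hyp n) : Fin n → ℝ := p.1.1

/-- Time coordinate of a point of the hyperboloid. -/
def Hyp.time {n : ℕ} (p : Hyp n) : ℝ := p.1.2

/-- The hyperbolic distance, `cosh d(p, q) = -⟨p, q⟩` for the Lorentzian product. -/
def hypDist {n : ℕ} (p q : Hyp n) : ℝ :=
  Real.arcosh (p.time * q.time - p.space ⬝ᵥ q.space)

/-- The group of isometries of hyperbolic `n`-space. -/
def HypIsometry (n : ℕ) : Type :=
  {g : Hyp n ≃ Hyp n // ∀ p q, hypDist (g p) (g q) = hypDist p q}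

instance (n : ℕ) : CoeFun (HypIsometry n) (fun _ => Hyp n → Hyp n) := ⟨fun g => g.1⟩

/-- The geodesic segment between two points. -/
def hypSegment {n : ℕ} (p q : Hyp n) : Set (Hyp n) :=
  {z | hypDist p z + hypDist z q = hypDist p q}

/-- The polytope cut out by the half-spaces with outward Lorentzian normals `(v, c)`, `v ∈ V`. -/
def polytope {n : ℕ} (V : Set (Fin n → ℝ)) (c : ℝ) : Set (Hyp n) :=
  {p | ∀ v ∈ V, v ⬝ᵥ p.space ≤ c * p.time}

/-- The face of `polytope V c` in the hyperplane with normal `(v, c)`. -/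
def polytopeFace {n : ℕ} (V : Set (Fin n → ℝ)) (c : ℝ) (v : Fin n → ℝ) : Set (Hyp n) :=
  {p | p ∈ polytope V c ∧ v ⬝ᵥ p.space = c * p.time}

/-- All vectors obtained from `w` by an even permutation of the coordinates and arbitrary changes
of signs. -/
def evenSignedPerms {n : ℕ} (w : Fin n → ℝ) : Set (Fin n → ℝ) :=
  {v | ∃ (σ : Equiv.Perm (Fin n)) (ε : Fin n → ℤˣ), Equiv.Perm.sign σ = 1 ∧
    ∀ i, v i = ((ε i : ℤ) : ℝ) * w (σ i)}

/-- The 12 vertices of the regular icosahedron, of square norm `φ ^ 2 + 1`; adjacent vertices have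
scalar product `φ`. They are the directions of the faces of the dual dodecahedron. -/
def icosahedron : Set (Fin 3 → ℝ) := evenSignedPerms ![φ, 1, 0]

/-- The 120 vertices of the regular 600-cell, of norm `1`; adjacent vertices have scalar product
`φ / 2`. They are the directions of the facets of the dual 120-cell. -/
def sixHundredCell : Set (Fin 4 → ℝ) :=
  evenSignedPerms ![1, 0, 0, 0] ∪ evenSignedPerms ![1 / 2, 1 / 2, 1 / 2, 1 / 2] ∪
    evenSignedPerms ![φ / 2, 1 / 2, φ⁻¹ / 2, 0]

/-- The regular right-angled hyperbolic dodecahedron: the normals `(v, √φ)` of adjacent faces are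
Lorentz-orthogonal. -/
def dodecahedron : Set (Hyp 3) := polytope icosahedron √φ

/-- The pentagonal face of the dodecahedron in direction `w`. -/
def dodFace (w : Fin 3 → ℝ) : Set (Hyp 3) := polytopeFace icosahedron √φ w

/-- The regular right-angled hyperbolic 120-cell: the normals `(v, √(φ / 2))` of adjacent facets
are Lorentz-orthogonal. -/
def cell120 : Set (Hyp 4) := polytope sixHundredCell √(φ / 2)

/-- The dodecahedral facet of the 120-cell in direction `v`. -/
def cellFacet (v : Fin 4 → ℝ) : Set (Hyp 4) := polytopeFace sixHundredCell √(φ / 2) v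

/-- The facet of the 120-cell that is identified with the dodecahedron. -/
def baseFacet : Set (Hyp 4) := cellFacet ![1, 0, 0, 0]

/-- The facet of the 120-cell that meets the base facet along the pentagon corresponding to the
face of the dodecahedron in direction `w`. -/
def sideFacet (w : Fin 3 → ℝ) : Set (Hyp 4) :=
  cellFacet (Fin.cons (φ / 2) fun i => w i / (2 * φ))

theorem two_mul_sq_sub_cube : 2 * φ ^ 2 - φ ^ 3 = 1 := by
  have h := Real.goldenRatio_sq
  have : φ ^ 3 = φ * φ ^ 2 := by ring
  rw [this, h]; linarith [show φ * (φ + 1) = φ ^ 2 + φ by ring]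

/-- The totally geodesic isometric inclusion of `ℍ³` in `ℍ⁴` onto the hyperplane that contains the
base facet. -/
def incl (p : Hyp 3) : Hyp 4 :=
  ⟨(Fin.cons (φ * √φ * p.time) p.space, √2 * φ * p.time), by
    obtain ⟨⟨x, t⟩, h, ht⟩ := p
    have h1 : √φ ^ 2 = φ := Real.sq_sqrt Real.goldenRatio_pos.le
    have h2 : (√2 : ℝ) ^ 2 = 2 := Real.sq_sqrt (by norm_num)
    have h3 := two_mul_sq_sub_cube
    simp only [Hyp.time, Hyp.space] at *
    refine ⟨?_, by have := Real.goldenRatio_pos; positivity⟩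
    simp only [dotProduct, Fin.sum_univ_succ (n := 3), Fin.cons_zero, Fin.cons_succ] at *
    have e1 : φ * √φ * t * (φ * √φ * t) = φ ^ 3 * t ^ 2 := by
      rw [show φ * √φ * t * (φ * √φ * t) = φ ^ 2 * √φ ^ 2 * t ^ 2 by ring, h1]; ring
    have e2 : (√2 * φ * t) ^ 2 = 2 * φ ^ 2 * t ^ 2 := by
      rw [show (√2 * φ * t) ^ 2 = √2 ^ 2 * φ ^ 2 * t ^ 2 by ring, h2]
    rw [e1, e2]
    have e3 : 2 * φ ^ 2 * t ^ 2 = t ^ 2 + φ ^ 3 * t ^ 2 := by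
      rw [show 2 * φ ^ 2 = 1 + φ ^ 3 by linarith]; ring
    linarith⟩

theorem dotProduct_self_of_mem_evenSignedPerms {n : ℕ} {w v : Fin n → ℝ}
    (h : v ∈ evenSignedPerms w) : v ⬝ᵥ v = w ⬝ᵥ w := by
  obtain ⟨σ, ε, -, hv⟩ := h
  simp only [dotProduct]
  rw [← Equiv.sum_comp σ (fun i => w i * w i)]
  refine Finset.sum_congr rfl fun i _ => ?_
  rw [hv i]
  rcases Int.units_eq_one_or (ε i) with h | h <;> simp [h]

theorem dotProduct_self_of_mem_sixHundredCell {v : Fin 4 → ℝ} (h : v ∈ sixHundredCell) :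
    v ⬝ᵥ v = 1 := by
  rcases h with (h | h) | h <;> rw [dotProduct_self_of_mem_evenSignedPerms h]
  · simp [dotProduct, Fin.sum_univ_four]
  · simp [dotProduct, Fin.sum_univ_four]; norm_num
  · simp only [dotProduct, Fin.sum_univ_four, Matrix.cons_val]
    rw [Real.inv_goldenRatio, show Real.goldenConj = 1 - φ by
      linarith [Real.goldenRatio_add_goldenConj]]
    nlinarith [Real.goldenRatio_sq]

/-- The 600-cell vertices are: the base direction, the 12 neighbours of the base direction, and
vectors whose first coordinate is at most `1 / 2`. -/
theorem sixHundredCell_cases {v : Fin 4 → ℝ} (h : v ∈ sixHundredCell) :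
    v = ![1, 0, 0, 0] ∨ (∃ w ∈ icosahedron, v = Fin.cons (φ / 2) fun i => w i / (2 * φ)) ∨
      v 0 ≤ 1 / 2 := by
  have hφ := Real.goldenRatio_pos
  have hφ1 := Real.one_lt_goldenRatio
  have hφi : φ⁻¹ < 1 := inv_lt_one_of_one_lt₀ hφ1
  have hφi0 : 0 < φ⁻¹ := inv_pos.2 hφ
  have hnorm := dotProduct_self_of_mem_sixHundredCell h
  rcases h with (h | h) | h
  · obtain ⟨σ, ε, -, hv⟩ := h
    have h0 := hv 0
    generalize hk : σ 0 = k at h0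
    rcases Int.units_eq_one_or (ε 0) with he | he <;> fin_cases k <;>
      simp [he] at h0
    · left
      simp only [dotProduct, Fin.sum_univ_four, h0] at hnorm
      have h1 : v 1 = 0 := by nlinarith [sq_nonneg (v 1), sq_nonneg (v 2), sq_nonneg (v 3)]
      have h2 : v 2 = 0 := by nlinarith [sq_nonneg (v 1), sq_nonneg (v 2), sq_nonneg (v 3)]
      have h3 : v 3 = 0 := by nlinarith [sq_nonneg (v 1), sq_nonneg (v 2), sq_nonneg (v 3)]
      ext i; fin_cases i <;> simp [h0, h1, h2, h3]
    all_goals right; right; linarith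
  · obtain ⟨σ, ε, -, hv⟩ := h
    have h0 := hv 0
    generalize hk : σ 0 = k at h0
    rcases Int.units_eq_one_or (ε 0) with he | he <;> fin_cases k <;>
      simp [he] at h0 <;> right <;> right <;> linarith
  · obtain ⟨σ, ε, hσ, hv⟩ := h
    have h0 := hv 0
    generalize hk : σ 0 = k at h0
    rcases Int.units_eq_one_or (ε 0) with he | he <;> fin_cases k <;>
      simp [he] at h0
    · right; left
      obtain ⟨⟨p, τ⟩, rfl⟩ := Equiv.Perm.decomposeFin.symm.surjective σ
      have hp : p = 0 := by simpa using hk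
      subst hp
      refine ⟨fun i => 2 * φ * v i.succ, ⟨τ, fun i => ε i.succ, by simpa using hσ, fun i => ?_⟩, ?_⟩
      · simp only [hv i.succ, Equiv.Perm.decomposeFin_symm_apply_succ, Equiv.swap_self,
          Equiv.refl_apply]
        generalize τ i = k
        fin_cases k <;> simp <;> field_simp
      · ext i
        refine Fin.cases ?_ (fun i => ?_) i
        · simpa using h0
        · simp; field_simp
    all_goals
      have h5 : 2 / (1 + √5) = φ⁻¹ := by rw [Real.goldenRatio, inv_div]
      rw [← h5] at hφi hφi0
      right; right; linarith

theorem incl_mem_cell120 {p : Hyp 3} (hp : p ∈ dodecahedron) : incl p ∈ cell120 := by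
  intro v hv
  have hφ := Real.goldenRatio_pos
  have hφ1 := Real.one_lt_goldenRatio
  have hsq := Real.goldenRatio_sq
  have ht : 0 < p.time := p.2.2
  have hpt : p.space ⬝ᵥ p.space - p.time ^ 2 = -1 := p.2.1
  have hs : 0 < √φ := Real.sqrt_pos.2 hφ
  have hs1 : √φ ^ 2 = φ := Real.sq_sqrt hφ.le
  have hb : √(φ / 2) * (√2 * φ * p.time) = φ * √φ * p.time := by
    rw [show √(φ / 2) * (√2 * φ * p.time) = (√(φ / 2) * √2) * φ * p.time by ring,
      ← Real.sqrt_mul (by positivity), div_mul_cancel₀ _ (by norm_num)]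
    ring
  have hnorm := dotProduct_self_of_mem_sixHundredCell hv
  change v ⬝ᵥ (Fin.cons (φ * √φ * p.time) p.space : Fin 4 → ℝ) ≤ √(φ / 2) * (√2 * φ * p.time)
  rw [hb]
  rcases sixHundredCell_cases hv with rfl | ⟨w, hw, rfl⟩ | h0
  · simp [dotProduct, Fin.sum_univ_succ]
  · have := hp w hw
    simp only [dotProduct, Fin.sum_univ_succ (n := 3), Fin.cons_zero, Fin.cons_succ] at this ⊢
    have e : ∑ i, w i / (2 * φ) * p.space i = (∑ i, w i * p.space i) / (2 * φ) := by
      rw [Finset.sum_div]; exact Finset.sum_congr rfl fun i _ => by ring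
    rw [e]
    have h1 : (∑ i, w i * p.space i) / (2 * φ) ≤ (√φ * p.time) / (2 * φ) := by gcongr
    refine (add_le_add_right h1 _).trans (le_of_eq ?_)
    have h3 := two_mul_sq_sub_cube
    generalize √φ = r at *
    generalize φ = f at *
    field_simp
    linear_combination -h3
  · simp only [dotProduct, Fin.sum_univ_four, Fin.sum_univ_three] at hnorm hpt ⊢
    have c1 : (Fin.cons (φ * √φ * p.time) p.space : Fin 4 → ℝ) 1 = p.space 0 := rfl
    have c2 : (Fin.cons (φ * √φ * p.time) p.space : Fin 4 → ℝ) 2 = p.space 1 := rfl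
    have c3 : (Fin.cons (φ * √φ * p.time) p.space : Fin 4 → ℝ) 3 = p.space 2 := rfl
    rw [c1, c2, c3, Fin.cons_zero]
    generalize p.space 0 = x at *
    generalize p.space 1 = y at *
    generalize p.space 2 = z at *
    generalize p.time = t at *
    generalize v 0 = a at *
    generalize v 1 = b at *
    generalize v 2 = c at *
    generalize v 3 = d at *
    have hk : (2 : ℝ) ≤ φ * √φ := by
      have : (2 : ℝ) ^ 2 ≤ (φ * √φ) ^ 2 := by
        rw [mul_pow, hs1, hsq]; nlinarith [show (3 / 2 : ℝ) ≤ φ by nlinarith]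
      exact (abs_le_of_sq_le_sq' this (by positivity)).2
    generalize φ * √φ = κ at *
    have ha1 : a ≤ 1 := by linarith
    have cs : (b * x + c * y + d * z) ^ 2 ≤
        (b * b + c * c + d * d) * (x * x + y * y + z * z) := by
      nlinarith [sq_nonneg (b * y - c * x), sq_nonneg (b * z - d * x), sq_nonneg (c * z - d * y)]
    have h1 : b * b + c * c + d * d = (1 - a) * (1 + a) := by linarith
    have h2 : x * x + y * y + z * z ≤ t ^ 2 := by linarith
    have ha2 : 0 ≤ (1 - a) * (1 + a) := by
      rw [← h1]; nlinarith [sq_nonneg b, sq_nonneg c, sq_nonneg d]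
    have h4 : (1 - a) * (1 + a) ≤ ((1 - a) * κ) ^ 2 := by
      have h5 : 1 + a ≤ (1 - a) * κ ^ 2 := by nlinarith
      have := mul_le_mul_of_nonneg_left h5 (sub_nonneg.2 ha1)
      linarith [show (1 - a) * ((1 - a) * κ ^ 2) = ((1 - a) * κ) ^ 2 by ring]
    have h6 : (b * x + c * y + d * z) ^ 2 ≤ ((1 - a) * κ * t) ^ 2 := by
      calc _ ≤ _ := cs
        _ ≤ (1 - a) * (1 + a) * t ^ 2 := by rw [h1]; gcongr
        _ ≤ ((1 - a) * κ) ^ 2 * t ^ 2 := by gcongr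
        _ = _ := by ring
    have h7 : b * x + c * y + d * z ≤ (1 - a) * κ * t := by
      refine abs_le_of_sq_le_sq' h6 ?_ |>.2
      have : 0 ≤ 1 - a := by linarith
      positivity
    linarith

/-- The dodecahedron as the base facet of the 120-cell. -/
def baseInclusion (p : dodecahedron) : cell120 := ⟨incl p.1, incl_mem_cell120 p.2⟩

/-! ### Hyperbolic structures on spaces glued from polytopes -/

/-- Let `X` be a space glued from the cells `{c} × Q` along isometries, with characteristic maps
`cellMap`. A hyperbolic chart of `X` is a homeomorphism from an open subset of `X` to an open subset
of `ℍⁿ` which, read in each cell, is locally the restriction of an isometry of `ℍⁿ`. -/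
def IsHyperbolicChart {n : ℕ} {X C : Type*} [TopologicalSpace X] {Q : Set (Hyp n)}
    (cellMap : C → Q → X) (e : OpenPartialHomeomorph X (Hyp n)) : Prop :=
  ∀ (c : C) (x : Q), cellMap c x ∈ e.source →
    ∃ g : HypIsometry n, ∀ᶠ y in 𝓝 x, e (cellMap c y) = g y.1

/-- The glued space is a hyperbolic `n`-manifold tessellated by the cells: hyperbolic charts cover
it. -/
def IsHyperbolicManifold {n : ℕ} {X C : Type*} [TopologicalSpace X] {Q : Set (Hyp n)}
    (cellMap : C → Q → X) : Prop :=
  ∀ p : X, ∃ e : OpenPartialHomeomorph X (Hyp n), IsHyperbolicChart cellMap e ∧ p ∈ e.source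

/-- `IsPathLength cellMap Y p q ℓ`: there is a path in `Y` from `p` to `q` of length `ℓ` that is a
finite concatenation of geodesic segments, each in one cell. -/
inductive IsPathLength {n : ℕ} {X C : Type*} {Q : Set (Hyp n)}
    (cellMap : C → Q → X) (Y : Set X) : X → X → ℝ → Prop
  | nil (p : X) : p ∈ Y → IsPathLength cellMap Y p p 0
  | cons (c : C) (x y : Q) (q : X) (ℓ : ℝ) :
      (∀ z : Q, z.1 ∈ hypSegment x.1 y.1 → cellMap c z ∈ Y) →
      IsPathLength cellMap Y (cellMap c y) q ℓ →
      IsPathLength cellMap Y (cellMap c x) q (hypDist x.1 y.1 + ℓ)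

/-- The intrinsic (path) distance of the subset `Y`: the infimum of the lengths of the paths in `Y`
between the two points, `∞` if there is none. -/
def intrinsicDist {n : ℕ} {X C : Type*} {Q : Set (Hyp n)}
    (cellMap : C → Q → X) (Y : Set X) (p q : X) : ENNReal :=
  ⨅ (ℓ : ℝ) (_ : IsPathLength cellMap Y p q ℓ), ENNReal.ofReal ℓ

/-- Two open subsets, with the intrinsic distances, are isometric. -/
def AreIsometric {n : ℕ} {X C : Type*} [TopologicalSpace X] {Q : Set (Hyp n)}
    (cellMap : C → Q → X) (Y Z : Set X) : Prop :=
  ∃ e : Y ≃ₜ Z, ∀ p q : Y,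
    intrinsicDist cellMap Z (e p) (e q) = intrinsicDist cellMap Y p q

/-- A map `f : M → N` from a hyperbolic 3-manifold to a hyperbolic 4-manifold (glued from polytopes)
is a totally geodesic embedding: a topological embedding which in suitable hyperbolic charts around
each point is the inclusion of `ℍ³` in `ℍ⁴`, the image being the slice `ℍ³` of the chart. -/
def IsTotallyGeodesicEmbedding {M N C C' : Type*} [TopologicalSpace M] [TopologicalSpace N]
    {Q : Set (Hyp 3)} {Q' : Set (Hyp 4)} (cellM : C → Q → M) (cellN : C' → Q' → N)
    (f : M → N) : Prop :=
  IsEmbedding f ∧ ∀ p : M,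
    ∃ (e : OpenPartialHomeomorph M (Hyp 3)) (e' : OpenPartialHomeomorph N (Hyp 4)),
      IsHyperbolicChart cellM e ∧ IsHyperbolicChart cellN e' ∧
      p ∈ e.source ∧ f p ∈ e'.source ∧
      (∀ q ∈ e.source, f q ∈ e'.source ∧ e' (f q) = incl (e q)) ∧
      (∀ q ∈ e'.source, q ∈ Set.range f ↔ e' q ∈ Set.range incl)

/-! ### Dodecahedral manifolds -/

/-- Gluing data for dodecahedra indexed by `ι`: the faces `(i, w)` of the dodecahedra are glued in
pairs. A gluing isometry between two pentagonal faces is recorded as the restriction of the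
symmetry of the regular dodecahedron that extends it. -/
structure DodecahedralGluing (ι : Type*) where
  /-- the face to which a face is glued -/
  pair : ι × icosahedron → ι × icosahedron
  /-- the symmetry of the dodecahedron that restricts to the gluing of the face `p` -/
  symm : ι × icosahedron → HypIsometry 3
  symm_image : ∀ p, symm p '' dodecahedron = dodecahedron
  symm_face : ∀ p, symm p '' dodFace p.2 = dodFace (pair p).2
  pair_pair : ∀ p, pair (pair p) = p
  symm_pair : ∀ p x, symm (pair p) (symm p x) = x

namespace DodecahedralGluing

variable {ι : Type*} (T : DodecahedralGluing ι)

/-- The identifications of points of the dodecahedra. -/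
inductive Rel : (Σ _ : ι, dodecahedron) → (Σ _ : ι, dodecahedron) → Prop
  | glue (i : ι) (w : icosahedron) (x y : dodecahedron) :
      x.1 ∈ dodFace w → y.1 = T.symm (i, w) x.1 → Rel ⟨i, x⟩ ⟨(T.pair (i, w)).1, y⟩

/-- The quotient `M` of the disjoint union of the dodecahedra. -/
def Space : Type _ := Quot T.Rel

instance : TopologicalSpace T.Space :=
  inferInstanceAs (TopologicalSpace (Quot T.Rel))

/-- The characteristic map of the `i`-th dodecahedron. -/
def cell (i : ι) (x : dodecahedron) : T.Space := Quot.mk _ ⟨i, x⟩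

/-! ### The manifold with corners `W'` built from 120-cells, and its mirror `W` -/

/-- `G` is the symmetry of the 120-cell that preserves the base facet and extends the symmetry `g`
of the dodecahedron. -/
def IsExtension (g : HypIsometry 3) (G : HypIsometry 4) : Prop :=
  G '' cell120 = cell120 ∧ ∀ z, G (incl z) = incl (g z)

/-- The identifications of points of the 120-cells, one for each dodecahedron: the gluing of the
faces `(i, w)` and `T.pair (i, w)` of the dodecahedra (the base facets) is extended to a gluing of
the side facets through these faces. -/
inductive CornerRel : (Σ _ : ι, cell120) → (Σ _ : ι, cell120) → Prop
  | glue (i : ι) (w : icosahedron) (G : HypIsometry 4) (x y : cell120) :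
      IsExtension (T.symm (i, w)) G → x.1 ∈ sideFacet w → y.1 = G x.1 →
      CornerRel ⟨i, x⟩ ⟨(T.pair (i, w)).1, y⟩

/-- The manifold with corners `W'`, which contains `M` as an isolated facet. -/
def Half : Type _ := Quot T.CornerRel

instance : TopologicalSpace T.Half := inferInstanceAs (TopologicalSpace (Quot T.CornerRel))

/-- The characteristic map of the `i`-th 120-cell of `W'`. -/
def halfCell (i : ι) (x : cell120) : T.Half := Quot.mk _ ⟨i, x⟩

/-- The isolated facet `M` of `W'`: the union of the base facets. -/
def baseOfHalf : Set T.Half := {p | ∃ (i : ι) (x : cell120), x.1 ∈ baseFacet ∧ p = T.halfCell i x}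

/-- The two copies of a point of the facet `M` of `W'` are identified. -/
inductive MirrorRel : Bool × T.Half → Bool × T.Half → Prop
  | glue (b b' : Bool) (p : T.Half) : p ∈ T.baseOfHalf → MirrorRel (b, p) (b', p)

/-- The manifold with corners `W`, the mirror of `W'` along its isolated facet `M`. -/
def Mirror : Type _ := Quot T.MirrorRel

instance : TopologicalSpace T.Mirror := inferInstanceAs (TopologicalSpace (Quot T.MirrorRel))

/-- The characteristic map of the 120-cell `(b, i)` of `W`, in the copy `b` of `W'`. -/
def mirrorCell (b : Bool) (i : ι) (x : cell120) : T.Mirror := Quot.mk _ (b, T.halfCell i x)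

/-! ### Facets and colourings -/

/-- A facet of a 120-cell of `W'` that is not glued to another one and is not a base facet, i.e. one
that does not meet the base facet. -/
def FreeCellFacet (ι : Type*) : Type _ :=
  ι × {v : sixHundredCell // Disjoint (cellFacet v) baseFacet}

/-- Two free facets of 120-cells belong to the same facet of `W'` if they are adjacent to glued side
facets and the gluing matches them. -/
inductive FacetRel : FreeCellFacet ι → FreeCellFacet ι → Prop
  | glue (i : ι) (w : icosahedron) (G : HypIsometry 4)
      (v v' : {v : sixHundredCell // Disjoint (cellFacet v) baseFacet}) :
      IsExtension (T.symm (i, w)) G → (cellFacet v.1 ∩ sideFacet w).Nonempty →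
      G '' cellFacet v.1 = cellFacet v'.1 → FacetRel (i, v) ((T.pair (i, w)).1, v')

/-- The facets of `W'` other than `M`. -/
def HalfFacet : Type _ := Quot T.FacetRel

/-- The facets of `W`: two copies of each facet of `W'` other than `M`. -/
abbrev Facet : Type _ := Bool × T.HalfFacet

/-- The involution of the set of facets of `W` that exchanges the two copies. -/
def facetSwap (F : T.Facet) : T.Facet := (!F.1, F.2)

/-- The subset of `W` underlying a facet. -/
def facetSet (F : T.Facet) : Set T.Mirror :=
  {p | ∃ (f : FreeCellFacet ι) (x : cell120),
    Quot.mk _ f = F.2 ∧ x.1 ∈ cellFacet f.2.1 ∧ p = T.mirrorCell F.1 f.1 x}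

/-- Two facets of `W` are adjacent if somewhere they meet at a corner, which is a corner of one of
the 120-cells. A facet that is not embedded is adjacent to itself. -/
def Adjacent (F F' : T.Facet) : Prop :=
  F.1 = F'.1 ∧ ∃ (i : ι) (v v' : {v : sixHundredCell // Disjoint (cellFacet v) baseFacet}),
    v ≠ v' ∧ (cellFacet v.1 ∩ cellFacet v'.1).Nonempty ∧
    Quot.mk _ (i, v) = F.2 ∧ Quot.mk _ (i, v') = F'.2

/-- A `k`-colouring of `W`. -/
def IsColouring {k : ℕ} (c : T.Facet → Fin k) : Prop :=
  Function.Surjective c ∧ ∀ F F', T.Adjacent F F' → c F ≠ c F'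

/-- A colouring is symmetric if it is invariant under the involution of the facets. -/
def IsSymmetric {k : ℕ} (c : T.Facet → Fin k) : Prop := c ∘ T.facetSwap = c

/-! ### The manifold `N` obtained from a colouring -/

/-- `W × {u}` and `W × {v}` are glued along the identity of a facet `F` if `u - v = e_{c(F)}`. -/
inductive ColourRel {k : ℕ} (c : T.Facet → Fin k) :
    T.Mirror × (Fin k → ZMod 2) → T.Mirror × (Fin k → ZMod 2) → Prop
  | glue (F : T.Facet) (p : T.Mirror) (u v : Fin k → ZMod 2) :
      p ∈ T.facetSet F → u - v = Pi.single (c F) 1 → ColourRel c (p, u) (p, v)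

/-- The space `N = (W × ℤ₂ᵏ) / ∼`. -/
def Coloured {k : ℕ} (c : T.Facet → Fin k) : Type _ := Quot (T.ColourRel c)

instance {k : ℕ} (c : T.Facet → Fin k) : TopologicalSpace (T.Coloured c) :=
  inferInstanceAs (TopologicalSpace (Quot (T.ColourRel c)))

/-- The characteristic map of the 120-cell `(b, i, u)` of `N`. -/
def colouredCell {k : ℕ} (c : T.Facet → Fin k) (j : Bool × ι × (Fin k → ZMod 2))
    (x : cell120) : T.Coloured c :=
  Quot.mk _ (T.mirrorCell j.1 j.2.1 x, j.2.2)

/-- The characteristic map of the dodecahedron `(i, u)` of `M × ℤ₂ᵏ`. -/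
def copiesCell (k : ℕ) (j : ι × (Fin k → ZMod 2)) (x : dodecahedron) :
    T.Space × (Fin k → ZMod 2) :=
  (T.cell j.1 x, j.2)

end DodecahedralGluing
end Dodecahedral

end

/-!
The manifold `N` has a global description near `M × ℤ₂ᵏ` in Fermi coordinates. The base facet of the
right-angled 120-cell spans a hyperplane of `ℍ⁴`, and every point of `ℍ⁴` is `fermi p h` for a
unique point `p = proj z` of `ℍ³` and a unique signed height `h = height z` over this hyperplane (the
hyperbolic sine of the distance). The facets that meet the base facet are orthogonal to it, so the
120-cell projects to the dodecahedron (`proj_mem_dodecahedron`), and up to height `1 / 10` it is the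
whole product of the dodecahedron and an interval (`fermi_mem_cell120`), disjoint from the facets
that do not meet the base facet (`height_of_mem_free_facet`).

The gluing isometries are compatible with these coordinates. A symmetry of the dodecahedron fixes
its centre (`map_origin`), acts linearly on the spatial coordinates and permutes the vertices of the
icosahedron (`spatial_mem_icosahedron`). Since the layers of the 600-cell are described by the
scalar products of these vertices (`mem_sixHundredCell_iff_layer`, a finite check over `ℤ[φ]`), the
isometry `extend g` of `ℍ⁴`, which acts on `proj` and keeps `height`, preserves the 120-cell
(`isExtension_extend`); on the 120-cell it is the only extension (`eq_extend_of_isExtension`).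

Hence the projection to `M` and the signed height, positive on one copy of `W'` and negative on the
other, descend to continuous maps on all of `N` (`colouredProj`, `colouredHeight`), and near
`M × ℤ₂ᵏ` so does the index in `ℤ₂ᵏ`. With the inverse map `collarMap` they identify the collar of
`M × {u}` with `M × (-1/20, 1/20)`. So `M × ℤ₂ᵏ` is embedded as the zero set of the height, and a
hyperbolic chart of `M` gives a chart of the collar (`collarChart`): in each 120-cell it is
`extend g`, up to the reflection in the hyperplane.

The sides `N₊` and `N₋` are the sets of positive and negative height. Over one `u`, the 120-cells
of one side without their base facets are star-shaped and all meet a parallel copy of the connected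
manifold `M`. As the colouring is symmetric, every colour occurs on that side, so the parts over `u`
and `u + e_j` meet (`sheet_inter_nonempty`), and the side is connected. Exchanging the two copies of
`W'` is an involution of `N` that maps cells to cells isometrically and exchanges the sides.
-/

open Topology
open scoped goldenRatio

namespace Dodecahedral

noncomputable section

/-! ### The Lorentz product on the hyperboloid -/

theorem Hyp.norm {n : ℕ} (p : Hyp n) : p.space ⬝ᵥ p.space = p.time ^ 2 - 1 := by
  have := p.2.1
  simp only [Hyp.space, Hyp.time]; linarith

theorem Hyp.time_pos {n : ℕ} (p : Hyp n) : 0 < p.time := p.2.2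

theorem Hyp.dotProduct_self_nonneg {n : ℕ} (x : Fin n → ℝ) : 0 ≤ x ⬝ᵥ x :=
  Finset.sum_nonneg fun i _ => mul_self_nonneg (x i)

theorem Hyp.one_le_time {n : ℕ} (p : Hyp n) : 1 ≤ p.time := by
  have h1 := p.norm
  have h2 := Hyp.dotProduct_self_nonneg p.space
  nlinarith [p.time_pos]

theorem Hyp.ext' {n : ℕ} {p q : Hyp n} (hs : p.space = q.space) (ht : p.time = q.time) : p = q :=
  Subtype.ext (Prod.ext hs ht)

theorem Hyp.ext_space {n : ℕ} {p q : Hyp n} (hs : p.space = q.space) : p = q := by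
  refine Hyp.ext' hs ?_
  have h1 := p.norm
  have h2 := q.norm
  rw [hs, h2] at h1
  nlinarith [p.time_pos, q.time_pos]

theorem Hyp.continuous_space {n : ℕ} : Continuous (Hyp.space : Hyp n → Fin n → ℝ) :=
  continuous_fst.comp continuous_subtype_val

theorem Hyp.continuous_time {n : ℕ} : Continuous (Hyp.time : Hyp n → ℝ) :=
  continuous_snd.comp continuous_subtype_val

theorem Hyp.continuous_of {n : ℕ} {X : Type*} [TopologicalSpace X] {f : X → Hyp n}
    (hs : Continuous fun x => (f x).space) (ht : Continuous fun x => (f x).time) :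
    Continuous f :=
  Continuous.subtype_mk (hs.prodMk ht) fun x => (f x).2

/-- The point of the hyperboloid with given spatial coordinates. -/
def ofSpace {n : ℕ} (x : Fin n → ℝ) : Hyp n :=
  ⟨(x, √(1 + x ⬝ᵥ x)), by
    have := Hyp.dotProduct_self_nonneg x
    refine ⟨?_, by positivity⟩
    rw [Real.sq_sqrt (by positivity)]; ring⟩

@[simp] theorem ofSpace_space {n : ℕ} (x : Fin n → ℝ) : (ofSpace x).space = x := rfl

theorem ofSpace_time {n : ℕ} (x : Fin n → ℝ) : (ofSpace x).time = √(1 + x ⬝ᵥ x) := rfl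

@[simp] theorem space_ofSpace {n : ℕ} (p : Hyp n) : ofSpace p.space = p := Hyp.ext_space rfl

theorem continuous_ofSpace {n : ℕ} : Continuous (ofSpace : (Fin n → ℝ) → Hyp n) := by
  refine Hyp.continuous_of continuous_id ?_
  simp only [ofSpace_time, dotProduct]
  fun_prop

/-- Minus the Lorentzian product, which is the hyperbolic cosine of the distance. -/
def coshDist {n : ℕ} (p q : Hyp n) : ℝ := p.time * q.time - p.space ⬝ᵥ q.space

theorem coshDist_comm {n : ℕ} (p q : Hyp n) : coshDist p q = coshDist q p := by
  simp only [coshDist, dotProduct_comm, mul_comm]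

theorem coshDist_self {n : ℕ} (p : Hyp n) : coshDist p p = 1 := by
  rw [coshDist, p.norm]; ring

/-- The identity behind the reversed Cauchy–Schwarz inequality. -/
theorem coshDist_key {n : ℕ} (p q : Hyp n) :
    (q.time • p.space - p.time • q.space) ⬝ᵥ (q.time • p.space - p.time • q.space)
      + (p.time - q.time) ^ 2 = 2 * (p.time * q.time) * (coshDist p q - 1) := by
  simp only [sub_dotProduct, dotProduct_sub, smul_dotProduct, dotProduct_smul, smul_eq_mul,
    coshDist, p.norm, q.norm, dotProduct_comm q.space p.space]
  ring

theorem one_le_coshDist {n : ℕ} (p q : Hyp n) : 1 ≤ coshDist p q := by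
  have h := coshDist_key p q
  have h1 := Hyp.dotProduct_self_nonneg (q.time • p.space - p.time • q.space)
  have h2 : 0 < p.time * q.time := mul_pos p.time_pos q.time_pos
  by_contra hlt
  nlinarith [sq_nonneg (p.time - q.time)]

theorem eq_of_coshDist_eq_one {n : ℕ} {p q : Hyp n} (h1 : coshDist p q = 1) : p = q := by
  have h := coshDist_key p q
  have h2 := Hyp.dotProduct_self_nonneg (q.time • p.space - p.time • q.space)
  rw [h1, sub_self, mul_zero] at h
  have h3 : p.time = q.time := by nlinarith [sq_nonneg (p.time - q.time)]
  have h4 : (q.time • p.space - p.time • q.space) ⬝ᵥ (q.time • p.space - p.time • q.space) = 0 := by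
    nlinarith [sq_nonneg (p.time - q.time)]
  have h5 := dotProduct_self_eq_zero.1 h4
  rw [h3, ← smul_sub, smul_eq_zero, sub_eq_zero] at h5
  exact Hyp.ext_space (h5.resolve_left q.time_pos.ne')

theorem hypDist_eq {n : ℕ} (p q : Hyp n) : hypDist p q = Real.arcosh (coshDist p q) := rfl

theorem HypIsometry.coshDist_map {n : ℕ} (g : HypIsometry n) (p q : Hyp n) :
    coshDist (g p) (g q) = coshDist p q :=
  Real.arcosh_injOn (one_le_coshDist _ _) (one_le_coshDist _ _) (g.2 p q)

/-- A bijection of the hyperboloid that preserves Lorentz products is an isometry. -/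
def HypIsometry.mk' {n : ℕ} (g : Hyp n ≃ Hyp n)
    (hg : ∀ p q, coshDist (g p) (g q) = coshDist p q) : HypIsometry n :=
  ⟨g, fun p q => by rw [hypDist_eq, hypDist_eq, hg]⟩

/-- The inverse isometry. -/
def HypIsometry.inv {n : ℕ} (g : HypIsometry n) : HypIsometry n :=
  HypIsometry.mk' g.1.symm fun p q => by
    have := g.coshDist_map (g.1.symm p) (g.1.symm q)
    simpa using this.symm

@[simp] theorem HypIsometry.apply_inv {n : ℕ} (g : HypIsometry n) (p : Hyp n) : g (g.inv p) = p :=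
  g.1.apply_symm_apply p

@[simp] theorem HypIsometry.inv_apply {n : ℕ} (g : HypIsometry n) (p : Hyp n) : g.inv (g p) = p :=
  g.1.symm_apply_apply p

theorem HypIsometry.inv_image {n : ℕ} (g : HypIsometry n) {S : Set (Hyp n)} (h : g '' S = S) :
    g.inv '' S = S := by
  conv_lhs => rw [← h]
  rw [← Set.image_comp]
  simp

/-- The composition of two isometries. -/
def HypIsometry.comp {n : ℕ} (g h : HypIsometry n) : HypIsometry n :=
  HypIsometry.mk' (h.1.trans g.1) fun p q =>
    (g.coshDist_map (h p) (h q)).trans (h.coshDist_map p q)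

theorem HypIsometry.comp_apply {n : ℕ} (g h : HypIsometry n) (p : Hyp n) :
    g.comp h p = g (h p) := rfl

/-! ### Fermi coordinates along the base hyperplane -/

/-- The hyperbolic cosine of the distance from the base hyperplane to the centre of the
120-cell. -/
def boostCosh : ℝ := √2 * φ

/-- The hyperbolic sine of the distance from the base hyperplane to the centre of the 120-cell. -/
def boostSinh : ℝ := φ * √φ

theorem boostCosh_pos : 0 < boostCosh := by
  have := Real.goldenRatio_pos
  unfold boostCosh; positivity

theorem boostSinh_pos : 0 < boostSinh := by
  have := Real.goldenRatio_pos
  unfold boostSinh; positivity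

theorem boost_sq : boostCosh ^ 2 = boostSinh ^ 2 + 1 := by
  have h1 : √φ ^ 2 = φ := Real.sq_sqrt Real.goldenRatio_pos.le
  have h2 : (√2 : ℝ) ^ 2 = 2 := Real.sq_sqrt (by norm_num)
  rw [boostCosh, boostSinh, mul_pow, mul_pow, h1, h2]
  linarith [two_mul_sq_sub_cube, show φ ^ 2 * φ = φ ^ 3 by ring]

/-- The point of `ℍ⁴` on the geodesic orthogonal to the base hyperplane at `incl p`, whose signed
distance to the hyperplane has hyperbolic sine `h`, positive on the side of the 120-cell. -/
def fermi (p : Hyp 3) (h : ℝ) : Hyp 4 :=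
  ⟨(Fin.cons (boostSinh * (√(1 + h ^ 2) * p.time) - boostCosh * h) (√(1 + h ^ 2) • p.space),
    boostCosh * (√(1 + h ^ 2) * p.time) - boostSinh * h), by
    have h1 : √(1 + h ^ 2) ^ 2 = 1 + h ^ 2 := Real.sq_sqrt (by positivity)
    have h2 := boost_sq
    have h3 := p.norm
    have h4 : |h| < √(1 + h ^ 2) := by
      rw [← Real.sqrt_sq_eq_abs]; exact Real.sqrt_lt_sqrt (sq_nonneg h) (by linarith)
    have h5 := p.one_le_time
    have hA := boostCosh_pos
    have hB := boostSinh_pos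
    generalize √(1 + h ^ 2) = r at *
    refine ⟨?_, ?_⟩
    · have h6 : (Fin.cons (boostSinh * (r * p.time) - boostCosh * h) (r • p.space) : Fin 4 → ℝ) ⬝ᵥ
          Fin.cons (boostSinh * (r * p.time) - boostCosh * h) (r • p.space) =
          (boostSinh * (r * p.time) - boostCosh * h) ^ 2 + r ^ 2 * (p.space ⬝ᵥ p.space) := by
        simp only [dotProduct, Fin.sum_univ_succ (n := 3), Fin.cons_zero, Fin.cons_succ,
          Finset.mul_sum]
        rw [sq]; congr 1
        exact Finset.sum_congr rfl fun i _ => by simp; ring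
      simp only
      rw [h6, h3]
      linear_combination (h ^ 2 - r ^ 2 * p.time ^ 2) * h2 - h1
    · have h6 : boostSinh < boostCosh := by nlinarith
      have h7 : boostSinh * h ≤ boostSinh * |h| := by gcongr; exact le_abs_self h
      have h8 : boostSinh * |h| ≤ boostCosh * |h| := by gcongr
      have h9 : boostCosh * |h| < boostCosh * (r * p.time) := by
        gcongr
        nlinarith [abs_nonneg h]
      simp only
      linarith⟩

/-- The hyperbolic sine of the signed distance to the base hyperplane. -/
def height (z : Hyp 4) : ℝ := boostSinh * z.time - boostCosh * z.space 0

theorem boost_identity (s t : ℝ) :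
    (boostCosh * t - boostSinh * s) ^ 2 = t ^ 2 - s ^ 2 + (boostSinh * t - boostCosh * s) ^ 2 := by
  linear_combination (t ^ 2 - s ^ 2) * boost_sq

theorem dotProduct_four (x y : Fin 4 → ℝ) : x ⬝ᵥ y = x 0 * y 0 + Fin.tail x ⬝ᵥ Fin.tail y := by
  simp only [dotProduct, Fin.sum_univ_succ (n := 3)]; rfl

theorem boost_time_pos (z : Hyp 4) : 0 < boostCosh * z.time - boostSinh * z.space 0 := by
  have h1 := z.norm
  rw [dotProduct_four] at h1
  have h2 := Hyp.dotProduct_self_nonneg (Fin.tail z.space)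
  have h3 : |z.space 0| ≤ z.time := abs_le_of_sq_le_sq (by nlinarith) z.time_pos.le
  have hA := boostCosh_pos
  have hB := boostSinh_pos
  have h6 : boostSinh < boostCosh := by nlinarith [boost_sq]
  have h7 : boostSinh * z.space 0 ≤ boostSinh * |z.space 0| := by gcongr; exact le_abs_self _
  have h8 : boostSinh * |z.space 0| ≤ boostSinh * z.time := by gcongr
  have h9 : boostSinh * z.time < boostCosh * z.time := by
    have := z.time_pos
    gcongr
  linarith

/-- The orthogonal projection of `ℍ⁴` to the base hyperplane, identified with `ℍ³`. -/
def proj (z : Hyp 4) : Hyp 3 :=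
  ⟨((√(1 + height z ^ 2))⁻¹ • Fin.tail z.space,
    (√(1 + height z ^ 2))⁻¹ * (boostCosh * z.time - boostSinh * z.space 0)), by
    have h0 : 0 < √(1 + height z ^ 2) := by positivity
    have h1 : √(1 + height z ^ 2) ^ 2 = 1 + height z ^ 2 := Real.sq_sqrt (by positivity)
    have h2 := z.norm
    rw [dotProduct_four] at h2
    refine ⟨?_, mul_pos (inv_pos.2 h0) (boost_time_pos z)⟩
    simp only [smul_dotProduct, dotProduct_smul, smul_eq_mul]
    rw [show Fin.tail z.space ⬝ᵥ Fin.tail z.space = z.time ^ 2 - 1 - z.space 0 * z.space 0 by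
      linarith, mul_pow, boost_identity]
    rw [height] at h1 h0 ⊢
    generalize √(1 + (boostSinh * z.time - boostCosh * z.space 0) ^ 2) = r at *
    field_simp
    rw [h1]; ring⟩

@[simp] theorem fermi_space_zero (p : Hyp 3) (h : ℝ) :
    (fermi p h).space 0 = boostSinh * (√(1 + h ^ 2) * p.time) - boostCosh * h := rfl

@[simp] theorem fermi_tail (p : Hyp 3) (h : ℝ) :
    Fin.tail (fermi p h).space = √(1 + h ^ 2) • p.space := rfl

@[simp] theorem fermi_time (p : Hyp 3) (h : ℝ) :
    (fermi p h).time = boostCosh * (√(1 + h ^ 2) * p.time) - boostSinh * h := rfl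

theorem proj_space (z : Hyp 4) :
    (proj z).space = (√(1 + height z ^ 2))⁻¹ • Fin.tail z.space := rfl

theorem proj_time (z : Hyp 4) : (proj z).time =
    (√(1 + height z ^ 2))⁻¹ * (boostCosh * z.time - boostSinh * z.space 0) := rfl

@[simp] theorem height_fermi (p : Hyp 3) (h : ℝ) : height (fermi p h) = h := by
  rw [height, fermi_time, fermi_space_zero]
  linear_combination h * boost_sq

@[simp] theorem proj_fermi (p : Hyp 3) (h : ℝ) : proj (fermi p h) = p := by
  refine Hyp.ext_space ?_
  have : √(1 + h ^ 2) ≠ 0 := by positivity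
  rw [proj_space, height_fermi, fermi_tail, smul_smul, inv_mul_cancel₀ this, one_smul]

theorem ext_four {z w : Hyp 4} (h0 : z.space 0 = w.space 0)
    (ht : Fin.tail z.space = Fin.tail w.space) : z = w := by
  refine Hyp.ext_space ?_
  rw [← Fin.cons_self_tail z.space, ← Fin.cons_self_tail w.space, h0, ht]

@[simp] theorem fermi_proj (z : Hyp 4) : fermi (proj z) (height z) = z := by
  have h0 : √(1 + height z ^ 2) ≠ 0 := by positivity
  refine ext_four ?_ ?_
  · rw [fermi_space_zero, proj_time, mul_inv_cancel_left₀ h0, height]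
    linear_combination z.space 0 * boost_sq
  · rw [fermi_tail, proj_space, smul_smul, mul_inv_cancel₀ h0, one_smul]

theorem fermi_zero (p : Hyp 3) : fermi p 0 = incl p := by
  refine ext_four ?_ ?_
  · change boostSinh * (√(1 + (0 : ℝ) ^ 2) * p.time) - boostCosh * 0 = φ * √φ * p.time
    rw [show √(1 + (0 : ℝ) ^ 2) = 1 by simp, boostSinh]; ring
  · change √(1 + (0 : ℝ) ^ 2) • p.space = p.space
    simp

theorem coshDist_fermi (p q : Hyp 3) (h h' : ℝ) : coshDist (fermi p h) (fermi q h') =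
    √(1 + h ^ 2) * √(1 + h' ^ 2) * coshDist p q - h * h' := by
  rw [coshDist, dotProduct_four]
  simp only [fermi_space_zero, fermi_tail, fermi_time, smul_dotProduct, dotProduct_smul,
    smul_eq_mul, coshDist]
  linear_combination (√(1 + h ^ 2) * √(1 + h' ^ 2) * (p.time * q.time) - h * h') * boost_sq

theorem continuous_fermi : Continuous fun x : Hyp 3 × ℝ => fermi x.1 x.2 := by
  have h1 : Continuous fun x : Hyp 3 × ℝ => x.1.time := Hyp.continuous_time.comp continuous_fst
  have h2 : Continuous fun x : Hyp 3 × ℝ => x.1.space := Hyp.continuous_space.comp continuous_fst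
  refine Hyp.continuous_of ?_ ?_
  · have : ∀ x : Hyp 3 × ℝ, (fermi x.1 x.2).space =
        Fin.cons (boostSinh * (√(1 + x.2 ^ 2) * x.1.time) - boostCosh * x.2)
          (√(1 + x.2 ^ 2) • x.1.space) := fun _ => rfl
    simp only [this]
    refine continuous_pi fun i => Fin.cases ?_ (fun i => ?_) i
    · simp only [Fin.cons_zero]; fun_prop
    · simp only [Fin.cons_succ]
      exact (continuous_apply i).comp (by fun_prop)
  · simp only [fermi_time]; fun_prop

theorem continuous_height : Continuous height := by
  have h1 := Hyp.continuous_time (n := 4)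
  have h2 := (continuous_apply (0 : Fin 4)).comp (Hyp.continuous_space (n := 4))
  exact (continuous_const.mul h1).sub (continuous_const.mul h2)

theorem continuous_proj : Continuous proj := by
  have h1 := Hyp.continuous_time (n := 4)
  have h2 := (continuous_apply (0 : Fin 4)).comp (Hyp.continuous_space (n := 4))
  have h3 : Continuous fun z : Hyp 4 => (√(1 + height z ^ 2))⁻¹ := by
    have := continuous_height
    refine Continuous.inv₀ (by fun_prop) fun z => ?_
    positivity
  refine Hyp.continuous_of ?_ ?_
  · simp only [proj_space]
    refine h3.smul (continuous_pi fun i => ?_)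
    exact (continuous_apply i.succ).comp (Hyp.continuous_space (n := 4))
  · simp only [proj_time]
    exact h3.mul ((continuous_const.mul h1).sub (continuous_const.mul h2))

/-- The isometry of `ℍ⁴` that extends an isometry of the base hyperplane and preserves its
sides. -/
def extend (g : HypIsometry 3) : HypIsometry 4 :=
  HypIsometry.mk'
    { toFun := fun z => fermi (g (proj z)) (height z)
      invFun := fun z => fermi (g.inv (proj z)) (height z)
      left_inv := fun z => by simp
      right_inv := fun z => by simp }
    fun z w => by
      change coshDist (fermi _ _) (fermi _ _) = _
      rw [coshDist_fermi, g.coshDist_map, ← coshDist_fermi, fermi_proj, fermi_proj]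

theorem extend_apply (g : HypIsometry 3) (z : Hyp 4) :
    extend g z = fermi (g (proj z)) (height z) := rfl

theorem extend_fermi (g : HypIsometry 3) (p : Hyp 3) (h : ℝ) :
    extend g (fermi p h) = fermi (g p) h := by simp [extend_apply]

/-- The reflection of `ℍ⁴` in the base hyperplane. -/
def baseReflection : HypIsometry 4 :=
  HypIsometry.mk'
    { toFun := fun z => fermi (proj z) (-height z)
      invFun := fun z => fermi (proj z) (-height z)
      left_inv := fun z => by simp
      right_inv := fun z => by simp }
    fun z w => by
      change coshDist (fermi _ _) (fermi _ _) = _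
      conv_rhs => rw [← fermi_proj z, ← fermi_proj w]
      rw [coshDist_fermi, coshDist_fermi, neg_sq, neg_sq, neg_mul_neg]

theorem baseReflection_apply (z : Hyp 4) : baseReflection z = fermi (proj z) (-height z) := rfl

/-- An isometry of `ℍ⁴` that extends `g` agrees with `extend g` at the points that it does not move
to the other side of the base hyperplane. -/
theorem eq_extend_of_height_nonneg {g : HypIsometry 3} {G : HypIsometry 4}
    (hG : ∀ z, G (incl z) = incl (g z)) {z : Hyp 4} (hz : 0 ≤ height z)
    (hz' : 0 ≤ height (G z)) : G z = extend g z := by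
  have key : ∀ p, √(1 + height (G z) ^ 2) * coshDist (proj (G z)) (g p) =
      √(1 + height z ^ 2) * coshDist (proj z) p := by
    intro p
    have h1 := G.coshDist_map z (incl p)
    rw [hG, ← fermi_zero, ← fermi_zero] at h1
    conv_lhs at h1 => rw [← fermi_proj (G z)]
    conv_rhs at h1 => rw [← fermi_proj z]
    rw [coshDist_fermi, coshDist_fermi] at h1
    simpa using h1
  have k1 := key (proj z)
  have k2 := key (g.inv (proj (G z)))
  have k3 := g.coshDist_map (proj z) (g.inv (proj (G z)))
  rw [g.apply_inv, coshDist_self] at k2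
  rw [g.apply_inv] at k3
  rw [coshDist_self, coshDist_comm] at k1
  rw [← k3] at k2
  have hX := one_le_coshDist (g (proj z)) (proj (G z))
  have hr : 0 < √(1 + height z ^ 2) := by positivity
  have hr' : 0 < √(1 + height (G z) ^ 2) := by positivity
  have hr1 : √(1 + height z ^ 2) ^ 2 = 1 + height z ^ 2 := Real.sq_sqrt (by positivity)
  have hr1' : √(1 + height (G z) ^ 2) ^ 2 = 1 + height (G z) ^ 2 := Real.sq_sqrt (by positivity)
  have hX1 : coshDist (g (proj z)) (proj (G z)) = 1 := by nlinarith
  have h3 := eq_of_coshDist_eq_one hX1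
  rw [hX1, mul_one, mul_one] at k1
  rw [k1] at hr1'
  have h4 : height (G z) = height z := by nlinarith
  rw [extend_apply, h3, ← h4, fermi_proj]

/-! ### The 120-cell in Fermi coordinates -/

theorem cell_coeff_mul_boostCosh : √(φ / 2) * boostCosh = boostSinh := by
  have hφ := Real.goldenRatio_pos
  rw [boostCosh, boostSinh, ← mul_assoc, ← Real.sqrt_mul (by positivity),
    div_mul_cancel₀ _ (by norm_num)]
  ring

theorem cell_coeff_mul_boostSinh : √(φ / 2) * boostSinh = boostCosh * (φ / 2) := by
  have hφ := Real.goldenRatio_pos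
  have h : √(φ / 2) ^ 2 = φ / 2 := Real.sq_sqrt (by positivity)
  rw [← cell_coeff_mul_boostCosh]
  linear_combination boostCosh * h

/-- The defect of a point in Fermi coordinates from a facet hyperplane of the 120-cell. -/
theorem cell_defect (v : Fin 4 → ℝ) (p : Hyp 3) (h : ℝ) :
    √(φ / 2) * (fermi p h).time - v ⬝ᵥ (fermi p h).space =
      √(1 + h ^ 2) * ((1 - v 0) * (boostSinh * p.time) - Fin.tail v ⬝ᵥ p.space) -
        h * (boostCosh * (φ / 2 - v 0)) := by
  rw [dotProduct_four, fermi_time, fermi_space_zero, fermi_tail, dotProduct_smul, smul_eq_mul]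
  linear_combination √(1 + h ^ 2) * p.time * cell_coeff_mul_boostCosh -
    h * cell_coeff_mul_boostSinh

/-- The side facets are orthogonal to the base hyperplane: the height enters their equation only
through a positive factor. -/
theorem side_defect (w : Fin 3 → ℝ) (p : Hyp 3) (h : ℝ) :
    √(φ / 2) * (fermi p h).time -
      (Fin.cons (φ / 2) fun i => w i / (2 * φ) : Fin 4 → ℝ) ⬝ᵥ (fermi p h).space =
      √(1 + h ^ 2) * ((√φ * p.time - w ⬝ᵥ p.space) / (2 * φ)) := by
  have hφ := Real.goldenRatio_pos
  rw [cell_defect, Fin.cons_zero, sub_self, mul_zero, mul_zero, sub_zero, Fin.tail_cons]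
  have e : (fun i => w i / (2 * φ)) ⬝ᵥ p.space = (w ⬝ᵥ p.space) / (2 * φ) := by
    simp only [dotProduct]
    rw [Finset.sum_div]; exact Finset.sum_congr rfl fun i _ => by ring
  rw [e, boostSinh]
  congr 1
  have h3 := two_mul_sq_sub_cube
  generalize √φ = r at *
  generalize φ = f at *
  field_simp
  linear_combination r * p.time * h3

theorem base_mem_sixHundredCell : (![1, 0, 0, 0] : Fin 4 → ℝ) ∈ sixHundredCell :=
  Or.inl (Or.inl ⟨1, 1, by simp, fun i => by simp⟩)

theorem side_mem_sixHundredCell {w : Fin 3 → ℝ} (hw : w ∈ icosahedron) :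
    (Fin.cons (φ / 2) fun i => w i / (2 * φ) : Fin 4 → ℝ) ∈ sixHundredCell := by
  obtain ⟨τ, ε, hτ, hv⟩ := hw
  refine Or.inr ⟨Equiv.Perm.decomposeFin.symm (0, τ), Fin.cons 1 ε, by simpa using hτ, fun i => ?_⟩
  refine Fin.cases (by simp) (fun i => ?_) i
  have hφ := Real.goldenRatio_pos
  simp only [Fin.cons_succ, hv, Equiv.Perm.decomposeFin_symm_apply_succ, Equiv.swap_self,
    Equiv.refl_apply]
  rw [mul_div_assoc]
  congr 1
  generalize τ i = k
  fin_cases k <;> simp <;> field_simp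

theorem goldenRatio_half_lt : φ / 2 < 1 := by linarith [Real.goldenRatio_lt_two]

theorem base_defect (z : Hyp 4) : √(φ / 2) * z.time - (![1, 0, 0, 0] : Fin 4 → ℝ) ⬝ᵥ z.space =
    height z * (boostCosh * (1 - φ / 2)) := by
  have h0 : (Fin.tail ![1, 0, 0, 0] : Fin 3 → ℝ) = 0 := by
    ext i; fin_cases i <;> rfl
  conv_lhs => rw [← fermi_proj z]
  rw [cell_defect, h0, zero_dotProduct]
  simp
  ring

theorem base_defect_coeff_pos : 0 < boostCosh * (1 - φ / 2) :=
  mul_pos boostCosh_pos (by linarith [goldenRatio_half_lt])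

theorem height_nonneg {z : Hyp 4} (hz : z ∈ cell120) : 0 ≤ height z := by
  have h1 := base_defect z
  have h2 := hz _ base_mem_sixHundredCell
  by_contra h
  nlinarith [base_defect_coeff_pos]

theorem mem_baseFacet_iff {z : Hyp 4} : z ∈ baseFacet ↔ z ∈ cell120 ∧ height z = 0 := by
  refine and_congr_right fun _ => ?_
  have h1 := base_defect z
  have h2 := base_defect_coeff_pos
  constructor
  · intro h
    rw [h, sub_self] at h1
    exact (mul_eq_zero.1 h1.symm).resolve_right h2.ne'
  · intro h
    rw [h, zero_mul] at h1
    linarith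

theorem side_le_iff (w : Fin 3 → ℝ) (z : Hyp 4) :
    (Fin.cons (φ / 2) fun i => w i / (2 * φ) : Fin 4 → ℝ) ⬝ᵥ z.space ≤ √(φ / 2) * z.time ↔
      w ⬝ᵥ (proj z).space ≤ √φ * (proj z).time := by
  have hφ := Real.goldenRatio_pos
  have h := side_defect w (proj z) (height z)
  rw [fermi_proj] at h
  have hr : 0 < √(1 + height z ^ 2) := by positivity
  rw [← sub_nonneg, h, mul_nonneg_iff_of_pos_left hr, le_div_iff₀ (by positivity), zero_mul,
    sub_nonneg]

theorem side_eq_iff (w : Fin 3 → ℝ) (z : Hyp 4) :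
    (Fin.cons (φ / 2) fun i => w i / (2 * φ) : Fin 4 → ℝ) ⬝ᵥ z.space = √(φ / 2) * z.time ↔
      w ⬝ᵥ (proj z).space = √φ * (proj z).time := by
  have hφ := Real.goldenRatio_pos
  have h := side_defect w (proj z) (height z)
  rw [fermi_proj] at h
  have hr : √(1 + height z ^ 2) ≠ 0 := by positivity
  have h2 : 2 * φ ≠ 0 := by positivity
  rw [eq_comm, ← sub_eq_zero, h, mul_eq_zero, or_iff_right hr, div_eq_zero_iff, or_iff_left h2,
    sub_eq_zero, eq_comm]

/-- The side facets are orthogonal to the base facet, so the 120-cell projects to the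
dodecahedron. -/
theorem proj_mem_dodecahedron {z : Hyp 4} (hz : z ∈ cell120) : proj z ∈ dodecahedron :=
  fun w hw => (side_le_iff w z).1 (hz _ (side_mem_sixHundredCell hw))

theorem mem_sideFacet_iff {w : Fin 3 → ℝ} {z : Hyp 4} :
    z ∈ sideFacet w ↔ z ∈ cell120 ∧ proj z ∈ dodFace w := by
  constructor
  · rintro ⟨h1, h2⟩
    exact ⟨h1, proj_mem_dodecahedron h1, (side_eq_iff w z).1 h2⟩
  · rintro ⟨h1, -, h2⟩
    exact ⟨h1, (side_eq_iff w z).2 h2⟩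

/-- The facets of the 120-cell that are neither the base facet nor a side facet keep away from the
base facet: their hyperplanes do not meet the points of height at most `1 / 10`. -/
theorem far_facet_lt {v : Fin 4 → ℝ} (hv : v ∈ sixHundredCell) (hv0 : v 0 ≤ 1 / 2) (p : Hyp 3)
    {h : ℝ} (h0 : 0 ≤ h) (h1 : h ≤ 1 / 10) :
    v ⬝ᵥ (fermi p h).space < √(φ / 2) * (fermi p h).time := by
  rw [← sub_pos, cell_defect]
  have hφ := Real.goldenRatio_pos
  have hsq := Real.goldenRatio_sq
  have hφu : φ < 1.62 := by nlinarith
  have hφl : 1.6 < φ := by nlinarith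
  have hb : 2 ≤ boostSinh := by
    have h2 := boost_sq
    have h3 : boostCosh ^ 2 = 2 * φ ^ 2 := by
      rw [boostCosh, mul_pow, Real.sq_sqrt (by norm_num)]
    nlinarith [boostSinh_pos]
  have ha : boostCosh ≤ 2.3 := by
    have h3 : boostCosh ^ 2 = 2 * φ ^ 2 := by
      rw [boostCosh, mul_pow, Real.sq_sqrt (by norm_num)]
    nlinarith [boostCosh_pos]
  have ha0 := boostCosh_pos
  have hnorm := dotProduct_self_of_mem_sixHundredCell hv
  rw [dotProduct_four] at hnorm
  have ht := p.one_le_time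
  -- By Cauchy–Schwarz, as `1 + v 0 ≤ 3 * (1 - v 0)` and `3 ≤ (7 / 4) ^ 2`.
  have hx : Fin.tail v ⬝ᵥ p.space ≤ 7 / 4 * (1 - v 0) * p.time := by
    have hs := Hyp.dotProduct_self_nonneg
      (p.time • Fin.tail v - (7 / 4 * (1 - v 0)) • p.space)
    simp only [sub_dotProduct, dotProduct_sub, smul_dotProduct, dotProduct_smul, smul_eq_mul,
      p.norm, dotProduct_comm p.space (Fin.tail v)] at hs
    have hp : 0 < 7 / 4 * (1 - v 0) * p.time := by nlinarith
    have hn : Fin.tail v ⬝ᵥ Fin.tail v ≤ (7 / 4 * (1 - v 0)) ^ 2 := by nlinarith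
    have h5 : p.time ^ 2 * (Fin.tail v ⬝ᵥ Fin.tail v) ≤ p.time ^ 2 * (7 / 4 * (1 - v 0)) ^ 2 := by
      gcongr
    by_contra hlt
    push Not at hlt
    have h6 := mul_lt_mul_of_pos_left hlt hp
    nlinarith [sq_nonneg (7 / 4 * (1 - v 0))]
  have hr : 1 ≤ √(1 + h ^ 2) := Real.one_le_sqrt.2 (by nlinarith)
  have hd : 0 < 1 - v 0 := by linarith
  -- The gap `2 - 7 / 4` beats the term `2.3 * h` coming from the height.
  have h2 : (1 - v 0) / 4 ≤ (1 - v 0) * (boostSinh * p.time) - Fin.tail v ⬝ᵥ p.space := by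
    have : (1 - v 0) * (2 * p.time) ≤ (1 - v 0) * (boostSinh * p.time) := by gcongr
    nlinarith
  have h3 : (1 - v 0) / 4 ≤
      √(1 + h ^ 2) * ((1 - v 0) * (boostSinh * p.time) - Fin.tail v ⬝ᵥ p.space) := by
    nlinarith
  have h4 : h * (boostCosh * (φ / 2 - v 0)) ≤ 1 / 10 * (2.3 * (1 - v 0)) := by
    have h5 : boostCosh * (φ / 2 - v 0) ≤ boostCosh * (1 - v 0) := by
      have := goldenRatio_half_lt
      gcongr
    have h6 : boostCosh * (1 - v 0) ≤ 2.3 * (1 - v 0) := by gcongr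
    calc _ ≤ h * (2.3 * (1 - v 0)) := mul_le_mul_of_nonneg_left (h5.trans h6) h0
      _ ≤ _ := by gcongr
  linarith

/-- The part of the 120-cell near the base facet is a product. -/
theorem fermi_mem_cell120 {p : Hyp 3} (hp : p ∈ dodecahedron) {h : ℝ} (h0 : 0 ≤ h)
    (h1 : h ≤ 1 / 10) : fermi p h ∈ cell120 := by
  intro v hv
  rcases sixHundredCell_cases hv with rfl | ⟨w, hw, rfl⟩ | hv0
  · rw [← sub_nonneg, base_defect, height_fermi]
    exact mul_nonneg h0 base_defect_coeff_pos.le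
  · rw [side_le_iff, proj_fermi]
    exact hp w hw
  · exact (far_facet_lt hv hv0 p h0 h1).le

/-! ### Centres of facets -/

/-- The centre of the face with normal `(v, c)`: the point of its hyperplane closest to the origin
of the hyperboloid. -/
def faceCentre {n : ℕ} (c : ℝ) (v : Fin n → ℝ) : Hyp n :=
  ofSpace (√(c ^ 2 / (v ⬝ᵥ v * (v ⬝ᵥ v - c ^ 2))) • v)

theorem faceCentre_norm {n : ℕ} {c : ℝ} {v : Fin n → ℝ} (hv : c ^ 2 < v ⬝ᵥ v) :
    (faceCentre c v).space ⬝ᵥ (faceCentre c v).space = c ^ 2 / (v ⬝ᵥ v - c ^ 2) := by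
  have h0 : 0 < v ⬝ᵥ v := lt_of_le_of_lt (sq_nonneg c) hv
  have h1 : 0 < v ⬝ᵥ v - c ^ 2 := by linarith
  simp only [faceCentre, ofSpace_space, smul_dotProduct, dotProduct_smul, smul_eq_mul]
  rw [← mul_assoc, Real.mul_self_sqrt (by positivity)]
  field_simp

theorem faceCentre_time {n : ℕ} {c : ℝ} {v : Fin n → ℝ} (hv : c ^ 2 < v ⬝ᵥ v) :
    (faceCentre c v).time = √(v ⬝ᵥ v / (v ⬝ᵥ v - c ^ 2)) := by
  have h1 : 0 < v ⬝ᵥ v - c ^ 2 := by linarith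
  rw [faceCentre, ofSpace_time]
  have := faceCentre_norm hv
  simp only [faceCentre, ofSpace_space] at this
  rw [this]
  congr 1
  field_simp
  ring

theorem faceCentre_eq {n : ℕ} {c : ℝ} {v : Fin n → ℝ} (hc : 0 ≤ c) (hv : c ^ 2 < v ⬝ᵥ v) :
    v ⬝ᵥ (faceCentre c v).space = c * (faceCentre c v).time := by
  have h0 : 0 < v ⬝ᵥ v := lt_of_le_of_lt (sq_nonneg c) hv
  have h1 : 0 < v ⬝ᵥ v - c ^ 2 := by linarith
  rw [faceCentre_time hv, faceCentre, ofSpace_space, dotProduct_smul, smul_eq_mul]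
  rw [Real.sqrt_div (sq_nonneg c), Real.sqrt_sq hc, Real.sqrt_mul h0.le, Real.sqrt_div h0.le]
  have h2 : √(v ⬝ᵥ v) ≠ 0 := by positivity
  have h3 : √(v ⬝ᵥ v) * √(v ⬝ᵥ v) = v ⬝ᵥ v := Real.mul_self_sqrt h0.le
  have h4 : √(v ⬝ᵥ v - c ^ 2) ≠ 0 := by positivity
  rw [div_mul_eq_mul_div, ← mul_div_assoc, div_eq_div_iff (mul_ne_zero h2 h4) h4]
  linear_combination - c * √(v ⬝ᵥ v - c ^ 2) * h3

theorem dotProduct_le_of_norm_eq {n : ℕ} {v w : Fin n → ℝ} (h : w ⬝ᵥ w = v ⬝ᵥ v) :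
    w ⬝ᵥ v ≤ v ⬝ᵥ v := by
  have := Hyp.dotProduct_self_nonneg (v - w)
  simp only [sub_dotProduct, dotProduct_sub, h, dotProduct_comm v w] at this
  linarith

theorem faceCentre_mem {n : ℕ} {V : Set (Fin n → ℝ)} {c : ℝ} {v : Fin n → ℝ} (hc : 0 ≤ c)
    (hv : c ^ 2 < v ⬝ᵥ v) (hV : ∀ w ∈ V, w ⬝ᵥ w = v ⬝ᵥ v) :
    faceCentre c v ∈ polytopeFace V c v := by
  refine ⟨fun w hw => ?_, faceCentre_eq hc hv⟩
  rw [← faceCentre_eq hc hv]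
  simp only [faceCentre, ofSpace_space, dotProduct_smul, smul_eq_mul]
  gcongr
  exact dotProduct_le_of_norm_eq (hV w hw)

theorem icosahedron_norm {w : Fin 3 → ℝ} (hw : w ∈ icosahedron) : w ⬝ᵥ w = φ + 2 := by
  rw [dotProduct_self_of_mem_evenSignedPerms hw]
  simp [dotProduct, Fin.sum_univ_three]
  nlinarith [Real.goldenRatio_sq]

theorem sq_sqrt_goldenRatio_lt {w : Fin 3 → ℝ} (hw : w ∈ icosahedron) : √φ ^ 2 < w ⬝ᵥ w := by
  rw [icosahedron_norm hw, Real.sq_sqrt Real.goldenRatio_pos.le]; linarith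

theorem faceCentre_mem_dodFace {w : Fin 3 → ℝ} (hw : w ∈ icosahedron) :
    faceCentre √φ w ∈ dodFace w :=
  faceCentre_mem (Real.sqrt_nonneg _) (sq_sqrt_goldenRatio_lt hw) fun w' hw' => by
    rw [icosahedron_norm hw, icosahedron_norm hw']

theorem faceCentre_mem_cellFacet {v : Fin 4 → ℝ} (hv : v ∈ sixHundredCell) :
    faceCentre √(φ / 2) v ∈ cellFacet v := by
  have hφ := Real.goldenRatio_pos
  refine faceCentre_mem (Real.sqrt_nonneg _) ?_ fun w hw => ?_
  · rw [dotProduct_self_of_mem_sixHundredCell hv, Real.sq_sqrt (by positivity)]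
    exact goldenRatio_half_lt
  · rw [dotProduct_self_of_mem_sixHundredCell hv, dotProduct_self_of_mem_sixHundredCell hw]

/-- A facet of the 120-cell that is disjoint from the base facet lies beyond the height of the
product neighbourhood. -/
theorem height_of_mem_free_facet {v : Fin 4 → ℝ} (hv : v ∈ sixHundredCell)
    (hd : Disjoint (cellFacet v) baseFacet) {z : Hyp 4} (hz : z ∈ cellFacet v) :
    1 / 10 < height z := by
  have hv0 : v 0 ≤ 1 / 2 := by
    rcases sixHundredCell_cases hv with rfl | ⟨w, hw, rfl⟩ | hv0
    · exact (Set.disjoint_left.1 hd (faceCentre_mem_cellFacet hv)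
        (faceCentre_mem_cellFacet hv)).elim
    · have hc := faceCentre_mem_dodFace hw
      have hm : fermi (faceCentre √φ w) 0 ∈ cell120 :=
        fermi_mem_cell120 hc.1 le_rfl (by norm_num)
      have hs : fermi (faceCentre √φ w) 0 ∈ sideFacet w :=
        mem_sideFacet_iff.2 ⟨hm, by rwa [proj_fermi]⟩
      exact (Set.disjoint_left.1 hd hs (mem_baseFacet_iff.2 ⟨hm, height_fermi _ _⟩)).elim
    · exact hv0
  by_contra hlt
  have h := far_facet_lt hv hv0 (proj z) (height_nonneg hz.1) (not_lt.1 hlt)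
  rw [fermi_proj, hz.2] at h
  exact lt_irrefl _ h

/-! ### Connectedness of the 120-cell without its base facet -/

theorem mul_sqrt_le_sqrt {n : ℕ} (x : Fin n → ℝ) {s : ℝ} (h0 : 0 ≤ s) (h1 : s ≤ 1) :
    s * √(1 + x ⬝ᵥ x) ≤ √(1 + (s • x) ⬝ᵥ (s • x)) := by
  refine Real.le_sqrt_of_sq_le ?_
  have := Hyp.dotProduct_self_nonneg x
  rw [mul_pow, Real.sq_sqrt (by positivity)]
  simp only [smul_dotProduct, dotProduct_smul, smul_eq_mul]
  nlinarith

/-- In spatial coordinates the 120-cell without its base facet is star-shaped about `0`. -/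
theorem isPreconnected_cell120_diff_base :
    IsPreconnected {x : cell120 | 0 < height x.1} := by
  have hφ := Real.goldenRatio_pos
  have hstar : StarConvex ℝ (0 : Fin 4 → ℝ) {x | ofSpace x ∈ cell120 ∧ 0 < height (ofSpace x)} := by
    rw [starConvex_zero_iff]
    rintro x ⟨hx, hx'⟩ s h0 h1
    have hle := mul_sqrt_le_sqrt x h0 h1
    refine ⟨fun v hv => ?_, ?_⟩
    · have := hx v hv
      rw [ofSpace_space, ofSpace_time] at this ⊢
      rw [dotProduct_smul, smul_eq_mul]
      calc s * (v ⬝ᵥ x) ≤ s * (√(φ / 2) * √(1 + x ⬝ᵥ x)) := by gcongr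
        _ = √(φ / 2) * (s * √(1 + x ⬝ᵥ x)) := by ring
        _ ≤ _ := by gcongr
    · rcases h0.eq_or_lt with rfl | h0
      · simp [height, ofSpace_time, boostSinh_pos]
      · simp only [height, ofSpace_space, ofSpace_time, Pi.smul_apply, smul_eq_mul] at hx' ⊢
        have := mul_pos h0 hx'
        have h2 : boostSinh * (s * √(1 + x ⬝ᵥ x)) ≤
            boostSinh * √(1 + (s • x) ⬝ᵥ (s • x)) := by
          have := boostSinh_pos
          gcongr
        linarith
  have h0 : (0 : Fin 4 → ℝ) ∈ {x | ofSpace x ∈ cell120 ∧ 0 < height (ofSpace x)} :=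
    ⟨fun v _ => by
      rw [ofSpace_space, dotProduct_zero]
      exact mul_nonneg (Real.sqrt_nonneg _) (Hyp.time_pos _).le,
      by simp [height, ofSpace_time, boostSinh_pos]⟩
  have hc := (hstar.isPathConnected h0).isConnected.isPreconnected.image ofSpace
    continuous_ofSpace.continuousOn
  rw [← IsInducing.subtypeVal.isPreconnected_image]
  convert hc using 1
  ext z
  constructor
  · rintro ⟨x, hx, rfl⟩
    exact ⟨x.1.space, ⟨by rw [space_ofSpace]; exact x.2, by rw [space_ofSpace]; exact hx⟩,
      space_ofSpace _⟩
  · rintro ⟨x, ⟨hx, hx'⟩, rfl⟩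
    exact ⟨⟨_, hx⟩, hx', rfl⟩

/-! ### Symmetries of the dodecahedron -/

theorem finite_evenSignedPerms {n : ℕ} (w : Fin n → ℝ) : (evenSignedPerms w).Finite := by
  refine (Set.finite_range fun x : Equiv.Perm (Fin n) × (Fin n → ℤˣ) =>
    fun i => ((x.2 i : ℤ) : ℝ) * w (x.1 i)).subset ?_
  rintro v ⟨σ, ε, -, hv⟩
  exact ⟨(σ, ε), funext fun i => (hv i).symm⟩

theorem neg_mem_icosahedron {w : Fin 3 → ℝ} (hw : w ∈ icosahedron) : -w ∈ icosahedron := by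
  obtain ⟨σ, ε, hσ, hv⟩ := hw
  exact ⟨σ, fun i => -ε i, hσ, fun i => by simp [hv]⟩

theorem mem_icosahedron₀ (s t : ℤˣ) :
    (![((s : ℤ) : ℝ) * φ, ((t : ℤ) : ℝ), 0] : Fin 3 → ℝ) ∈ icosahedron :=
  ⟨1, ![s, t, 1], by simp, fun i => by fin_cases i <;> simp⟩

theorem mem_icosahedron₁ (s t : ℤˣ) :
    (![0, ((s : ℤ) : ℝ) * φ, ((t : ℤ) : ℝ)] : Fin 3 → ℝ) ∈ icosahedron :=
  ⟨(finRotate 3)⁻¹, ![1, s, t], by decide, fun i => by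
    fin_cases i
    · simp [show (finRotate 3)⁻¹ 0 = 2 by decide]
    · simp [show (finRotate 3)⁻¹ 1 = 0 by decide]
    · simp [show (finRotate 3)⁻¹ 2 = 1 by decide]⟩

theorem mem_icosahedron₂ (s t : ℤˣ) :
    (![((t : ℤ) : ℝ), 0, ((s : ℤ) : ℝ) * φ] : Fin 3 → ℝ) ∈ icosahedron :=
  ⟨finRotate 3, ![t, 1, s], by decide, fun i => by
    fin_cases i
    · simp [show finRotate 3 0 = 1 by decide]
    · simp [show finRotate 3 1 = 2 by decide]
    · simp [show finRotate 3 2 = 0 by decide]⟩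

theorem exists_unit_mul_eq_abs (x : ℝ) : ∃ s : ℤˣ, ((s : ℤ) : ℝ) * x = |x| := by
  rcases le_total 0 x with h | h
  · exact ⟨1, by simp [abs_of_nonneg h]⟩
  · exact ⟨-1, by simp [abs_of_nonpos h]⟩

/-- The estimate that bounds the dodecahedron: `X` is the largest absolute value of a coordinate,
and the hypotheses `h1`, `h2` are two of its face inequalities. -/
theorem sq_sum_le_of_max {f X Y Z m : ℝ} (hf : 1.6 ≤ f) (hX : 0 ≤ X) (hY : 0 ≤ Y) (hZ : 0 ≤ Z)
    (h1 : f * X + Y ≤ m) (h2 : f * Z + X ≤ m) (hYX : Y ≤ X) (hZX : Z ≤ X) :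
    X ^ 2 + Y ^ 2 + Z ^ 2 ≤ m ^ 2 / 2 := by
  have h1' : 1.6 * X + Y ≤ m := by nlinarith
  have h2' : 1.6 * Z + X ≤ m := by nlinarith
  have hY2 : Y ^ 2 ≤ Y * (m - 1.6 * X) := by nlinarith
  rcases le_total (2.6 * X) m with h | h
  · nlinarith
  · have hYb : Y ^ 2 ≤ (m - 1.6 * X) ^ 2 := by nlinarith
    have hZb : (1.6 * Z) ^ 2 ≤ (m - X) ^ 2 := by nlinarith
    nlinarith [mul_nonneg (sub_nonneg.2 h) (show 0 ≤ m - 1.6 * X by linarith)]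

/-- The dodecahedron is bounded. -/
theorem time_le_of_mem_dodecahedron {p : Hyp 3} (hp : p ∈ dodecahedron) : p.time ≤ 3 := by
  have hφ := Real.goldenRatio_pos
  have hsq := Real.goldenRatio_sq
  have hφu : φ < 1.62 := by nlinarith
  have hφl : 1.6 < φ := by nlinarith
  obtain ⟨s0, h0⟩ := exists_unit_mul_eq_abs (p.space 0)
  obtain ⟨s1, h1⟩ := exists_unit_mul_eq_abs (p.space 1)
  obtain ⟨s2, h2⟩ := exists_unit_mul_eq_abs (p.space 2)
  have k0 := hp _ (mem_icosahedron₀ s0 s1)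
  have k1 := hp _ (mem_icosahedron₁ s1 s2)
  have k2 := hp _ (mem_icosahedron₂ s2 s0)
  have hn := p.norm
  simp only [dotProduct, Fin.sum_univ_three, Matrix.cons_val] at k0 k1 k2 hn
  have k0' : φ * |p.space 0| + |p.space 1| ≤ √φ * p.time := by rw [← h0, ← h1]; linarith
  have k1' : φ * |p.space 1| + |p.space 2| ≤ √φ * p.time := by rw [← h1, ← h2]; linarith
  have k2' : φ * |p.space 2| + |p.space 0| ≤ √φ * p.time := by rw [← h2, ← h0]; linarith
  have a0 := abs_nonneg (p.space 0)
  have a1 := abs_nonneg (p.space 1)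
  have a2 := abs_nonneg (p.space 2)
  have hm : (√φ * p.time) ^ 2 = φ * p.time ^ 2 := by rw [mul_pow, Real.sq_sqrt hφ.le]
  have hsum : |p.space 0| ^ 2 + |p.space 1| ^ 2 + |p.space 2| ^ 2 ≤ (√φ * p.time) ^ 2 / 2 := by
    rcases le_total |p.space 0| |p.space 1| with c1 | c1 <;>
    rcases le_total |p.space 1| |p.space 2| with c2 | c2 <;>
    rcases le_total |p.space 0| |p.space 2| with c3 | c3
    · linarith [sq_sum_le_of_max hφl.le a2 a0 a1 k2' k1' c3 c2]
    · linarith [sq_sum_le_of_max hφl.le a2 a0 a1 k2' k1' (c1.trans c2) c2]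
    · linarith [sq_sum_le_of_max hφl.le a1 a2 a0 k1' k0' c2 c1]
    · linarith [sq_sum_le_of_max hφl.le a1 a2 a0 k1' k0' c2 c1]
    · linarith [sq_sum_le_of_max hφl.le a2 a0 a1 k2' k1' c3 c2]
    · linarith [sq_sum_le_of_max hφl.le a0 a1 a2 k0' k2' c1 c3]
    · linarith [sq_sum_le_of_max hφl.le a0 a1 a2 k0' k2' c1 (c2.trans c1)]
    · linarith [sq_sum_le_of_max hφl.le a0 a1 a2 k0' k2' c1 c3]
  rw [hm, sq_abs, sq_abs, sq_abs] at hsum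
  nlinarith [p.time_pos]

/-- The origin of the hyperboloid. -/
def origin (n : ℕ) : Hyp n := ofSpace 0

@[simp] theorem origin_space (n : ℕ) : (origin n).space = 0 := rfl

@[simp] theorem origin_time (n : ℕ) : (origin n).time = 1 := by simp [origin, ofSpace_time]

theorem coshDist_origin {n : ℕ} (p : Hyp n) : coshDist p (origin n) = p.time := by
  simp [coshDist]

theorem origin_mem_dodecahedron : origin 3 ∈ dodecahedron := fun w _ => by
  rw [origin_space, dotProduct_zero, origin_time]
  positivity

theorem neg_mem_dodecahedron {p : Hyp 3} (hp : p ∈ dodecahedron) :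
    ofSpace (-p.space) ∈ dodecahedron := by
  intro w hw
  have := hp _ (neg_mem_icosahedron hw)
  rw [neg_dotProduct] at this
  rw [ofSpace_space, dotProduct_neg, ofSpace_time, neg_dotProduct_neg, ← ofSpace_time,
    space_ofSpace]
  exact this

/-- A symmetry of the dodecahedron fixes its centre: by central symmetry every point has a point of
the dodecahedron at distance at least the circumradius, with equality only at the centre. -/
theorem map_origin {g : HypIsometry 3} (hg : g '' dodecahedron = dodecahedron) :
    g (origin 3) = origin 3 := by
  have hbdd : BddAbove (Hyp.time '' dodecahedron) := by
    refine ⟨3, ?_⟩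
    rintro _ ⟨p, hp, rfl⟩
    exact time_le_of_mem_dodecahedron hp
  set R := sSup (Hyp.time '' dodecahedron) with hR
  have hle : ∀ p ∈ dodecahedron, p.time ≤ R := fun p hp => le_csSup hbdd ⟨p, hp, rfl⟩
  have hR1 : 1 ≤ R := by simpa using hle _ origin_mem_dodecahedron
  set c := g.inv (origin 3) with hc
  have hdist : ∀ p ∈ dodecahedron, coshDist p c ≤ R := by
    intro p hp
    rw [← g.coshDist_map, hc, g.apply_inv, coshDist_origin]
    exact hle _ (hg ▸ ⟨p, hp, rfl⟩)
  -- The sum of the bounds at `p` and at its antipode.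
  have hmul : ∀ p ∈ dodecahedron, p.time ≤ R / c.time := by
    intro p hp
    have h1 := hdist p hp
    have h2 := hdist _ (neg_mem_dodecahedron hp)
    have h3 : (ofSpace (-p.space)).time = p.time := by
      rw [ofSpace_time, neg_dotProduct_neg, ← ofSpace_time, space_ofSpace]
    rw [coshDist] at h1 h2
    rw [h3, ofSpace_space, neg_dotProduct] at h2
    rw [le_div_iff₀ c.time_pos]
    linarith
  have hRc : R ≤ R / c.time :=
    csSup_le ⟨_, origin 3, origin_mem_dodecahedron, rfl⟩ (by rintro _ ⟨p, hp, rfl⟩; exact hmul p hp)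
  rw [le_div_iff₀ c.time_pos] at hRc
  have hc1 : c.time = 1 := le_antisymm (by nlinarith) c.one_le_time
  have : c = origin 3 := eq_of_coshDist_eq_one (by rw [coshDist_origin, hc1])
  exact (congrArg g this.symm).trans (g.apply_inv _)

/-- The action of an isometry on the spatial coordinates of the hyperboloid. -/
def spatial {n : ℕ} (g : HypIsometry n) (x : Fin n → ℝ) : Fin n → ℝ := (g (ofSpace x)).space

theorem time_map {n : ℕ} {g : HypIsometry n} (hg : g (origin n) = origin n) (p : Hyp n) :
    (g p).time = p.time := by
  rw [← coshDist_origin, ← hg, g.coshDist_map, coshDist_origin]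

theorem spatial_space {n : ℕ} (g : HypIsometry n) (p : Hyp n) :
    (g p).space = spatial g p.space := by rw [spatial, space_ofSpace]

theorem ofSpace_spatial {n : ℕ} (g : HypIsometry n) (x : Fin n → ℝ) :
    ofSpace (spatial g x) = g (ofSpace x) := space_ofSpace _

theorem spatial_dotProduct {n : ℕ} {g : HypIsometry n} (hg : g (origin n) = origin n)
    (x y : Fin n → ℝ) : spatial g x ⬝ᵥ spatial g y = x ⬝ᵥ y := by
  have := g.coshDist_map (ofSpace x) (ofSpace y)
  rw [coshDist, coshDist, time_map hg, time_map hg] at this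
  simpa [spatial] using this

/-- A map of Euclidean space that preserves scalar products is linear. -/
theorem combination_of_preserves_dotProduct {n : ℕ} {A : (Fin n → ℝ) → Fin n → ℝ}
    (hA : ∀ x y, A x ⬝ᵥ A y = x ⬝ᵥ y) (a b : ℝ) (x y : Fin n → ℝ) :
    A (a • x + b • y) = a • A x + b • A y := by
  rw [← sub_eq_zero, ← dotProduct_self_eq_zero]
  simp only [sub_dotProduct, dotProduct_sub, add_dotProduct, dotProduct_add, smul_dotProduct,
    dotProduct_smul, smul_eq_mul, hA]
  ring

theorem spatial_inv {n : ℕ} (g : HypIsometry n) (x : Fin n → ℝ) :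
    spatial g (spatial g.inv x) = x := by
  rw [spatial, ofSpace_spatial, g.apply_inv, ofSpace_space]

/-- A symmetry of the dodecahedron permutes the directions of its faces: the face centres are the
boundary points at minimal distance from the centre. -/
theorem spatial_mem_icosahedron {g : HypIsometry 3} (hg : g '' dodecahedron = dodecahedron)
    {w : Fin 3 → ℝ} (hw : w ∈ icosahedron) : spatial g w ∈ icosahedron := by
  have hφ := Real.goldenRatio_pos
  have hdot := spatial_dotProduct (map_origin hg)
  have hlin := combination_of_preserves_dotProduct hdot
  obtain ⟨r, hr, hrw⟩ : ∃ r : ℝ, 0 < r ∧ ∀ w' ∈ icosahedron,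
      (faceCentre √φ w').space = r • w' := by
    refine ⟨√(√φ ^ 2 / ((φ + 2) * ((φ + 2) - √φ ^ 2))), ?_, fun w' hw' => ?_⟩
    · rw [Real.sq_sqrt hφ.le]
      refine Real.sqrt_pos.2 (div_pos hφ (mul_pos (by positivity) (by linarith)))
    · rw [faceCentre, ofSpace_space, icosahedron_norm hw']
  have hsmul : ∀ s : ℝ, spatial g (s • w) = s • spatial g w := fun s => by
    simpa using hlin s 0 w 0
  have hw2 := faceCentre_eq (Real.sqrt_nonneg φ) (sq_sqrt_goldenRatio_lt hw)
  have hw3 : (faceCentre √φ w).time = √(1 + (r • w) ⬝ᵥ (r • w)) := by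
    rw [← hrw w hw, ← ofSpace_time, space_ofSpace]
  rw [hw3, hrw w hw, dotProduct_smul, smul_eq_mul, icosahedron_norm hw] at hw2
  -- Some face inequality is an equality at the image of the face centre, as otherwise the image
  -- could be moved outwards within the dodecahedron.
  obtain ⟨w', hw', hle⟩ : ∃ w' ∈ icosahedron,
      √φ * √(1 + (r • w) ⬝ᵥ (r • w)) ≤ w' ⬝ᵥ (r • spatial g w) := by
    by_contra hno
    push Not at hno
    have hev : ∀ᶠ s : ℝ in 𝓝 1, ∀ w' ∈ icosahedron,
        w' ⬝ᵥ (s • r • spatial g w) < √φ * √(1 + (s • r • w) ⬝ᵥ (s • r • w)) := by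
      refine (Filter.eventually_all_finite (finite_evenSignedPerms _)).2 ?_
      intro w' hw'
      have h1 : Continuous fun s : ℝ => w' ⬝ᵥ (s • r • spatial g w) := by
        simp only [dotProduct_smul]; fun_prop
      have h2 : Continuous fun s : ℝ => √φ * √(1 + (s • r • w) ⬝ᵥ (s • r • w)) := by
        simp only [dotProduct_smul, smul_dotProduct]; fun_prop
      exact h1.continuousAt.eventually_lt h2.continuousAt (by simpa using hno w' hw')
    obtain ⟨s, hs, hs1⟩ := ((hev.filter_mono nhdsWithin_le_nhds).and
      (self_mem_nhdsWithin (s := Set.Ioi (1 : ℝ)))).exists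
    have hs1 : 1 < s := hs1
    have hmem : ofSpace (s • r • w) ∈ dodecahedron := by
      have h1 : g (ofSpace (s • r • w)) ∈ dodecahedron := by
        rw [← ofSpace_spatial, smul_smul, hsmul]
        intro w' hw'
        have := hs w' hw'
        rw [ofSpace_space, ofSpace_time, ← hsmul, hdot, hsmul, ← smul_smul, ← smul_smul]
        exact this.le
      have h2 : g.inv (g (ofSpace (s • r • w))) ∈ g.inv '' dodecahedron := ⟨_, h1, rfl⟩
      rwa [g.inv_image hg, g.inv_apply] at h2
    have h3 := hmem w hw
    rw [ofSpace_space, ofSpace_time, dotProduct_smul, dotProduct_smul, icosahedron_norm hw] at h3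
    simp only [smul_eq_mul] at h3
    rw [hw2] at h3
    have hpos := Hyp.dotProduct_self_nonneg (r • w)
    have h4 : √(1 + (s • r • w) ⬝ᵥ (s • r • w)) < s * √(1 + (r • w) ⬝ᵥ (r • w)) := by
      rw [Real.sqrt_lt' (by positivity), mul_pow, Real.sq_sqrt (by positivity), smul_dotProduct s,
        dotProduct_smul s, smul_eq_mul, smul_eq_mul]
      nlinarith
    have h5 := mul_lt_mul_of_pos_left h4 (Real.sqrt_pos.2 hφ)
    linarith
  rw [← hw2, dotProduct_smul, smul_eq_mul, mul_le_mul_iff_right₀ hr] at hle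
  have hn : spatial g w ⬝ᵥ spatial g w = φ + 2 := by rw [hdot, icosahedron_norm hw]
  -- Equality in Cauchy–Schwarz.
  have hz : (w' - spatial g w) ⬝ᵥ (w' - spatial g w) = 0 := by
    refine le_antisymm ?_ (Hyp.dotProduct_self_nonneg _)
    simp only [sub_dotProduct, dotProduct_sub, hn, icosahedron_norm hw',
      dotProduct_comm (spatial g w) w']
    linarith
  rw [dotProduct_self_eq_zero, sub_eq_zero] at hz
  rwa [← hz]

/-! ### The layers of the 600-cell over the icosahedron -/

/-- The real number `a + b φ` given by a pair of integers. -/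
def evalGolden (x : ℤ × ℤ) : ℝ := x.1 + x.2 * φ

theorem evalGolden_add (x y : ℤ × ℤ) : evalGolden (x + y) = evalGolden x + evalGolden y := by
  simp only [evalGolden, Prod.fst_add, Prod.snd_add]; push_cast; ring

theorem evalGolden_neg (x : ℤ × ℤ) : evalGolden (-x) = -evalGolden x := by
  simp only [evalGolden, Prod.fst_neg, Prod.snd_neg]; push_cast; ring

theorem evalGolden_injective : Function.Injective evalGolden := by
  intro x y h
  simp only [evalGolden] at h
  have h2 : x.2 = y.2 := by
    by_contra hne
    refine Real.goldenRatio_irrational ⟨((y.1 - x.1 : ℤ) : ℚ) / ((x.2 - y.2 : ℤ) : ℚ), ?_⟩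
    have h3 : ((x.2 : ℝ) - y.2) ≠ 0 := by
      rw [sub_ne_zero]; exact_mod_cast hne
    push_cast
    rw [div_eq_iff h3]
    linarith
  rw [h2] at h
  exact Prod.ext (by exact_mod_cast add_right_cancel h) h2

end

/-- The product of `ℤ[φ]` on pairs of integers. -/
def goldenMul (x y : ℤ × ℤ) : ℤ × ℤ :=
  (x.1 * y.1 + x.2 * y.2, x.1 * y.2 + x.2 * y.1 + x.2 * y.2)

/-- The vertices of the icosahedron, with coordinates in `ℤ[φ]`. -/
def goldenIcosahedron (k : Fin 3) (s t : ℤˣ) (i : Fin 3) : ℤ × ℤ :=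
  if i = k then (0, s) else if i = k + 1 then (t, 0) else (0, 0)

/-- The scalar product of vectors with coordinates in `ℤ[φ]`. -/
def goldenDot (x y : Fin 3 → ℤ × ℤ) : ℤ × ℤ :=
  goldenMul (x 0) (y 0) + goldenMul (x 1) (y 1) + goldenMul (x 2) (y 2)

/-- Twice the three vectors whose even signed permutations form the 600-cell. -/
def goldenSeed : Fin 3 → Fin 4 → ℤ × ℤ :=
  ![![(2, 0), (0, 0), (0, 0), (0, 0)], ![(1, 0), (1, 0), (1, 0), (1, 0)],
    ![(0, 1), (1, 0), (-1, 1), (0, 0)]]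

/-- An entry `(s, α, β, d)` stands for the layer of the vertices `(s, α w + β w') / 2` of the
600-cell, for vertices `w`, `w'` of the icosahedron with scalar product `d`. -/
def goldenLayers : List ((ℤ × ℤ) × (ℤ × ℤ) × (ℤ × ℤ) × (ℤ × ℤ)) :=
  [((2, 0), (0, 0), (0, 0), (0, 1)), ((-2, 0), (0, 0), (0, 0), (0, 1)),
    ((0, 1), (-1, 1), (0, 0), (0, 1)), ((0, -1), (-1, 1), (0, 0), (0, 1)),
    ((-1, 1), (1, 0), (0, 0), (0, 1)), ((1, -1), (1, 0), (0, 0), (0, 1)),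
    ((0, 0), (-1, 1), (-1, 1), (0, 1)), ((1, 0), (1, 0), (-1, 1), (0, -1)),
    ((-1, 0), (1, 0), (-1, 1), (0, -1))]

/-- The vector `(s, α w + β w')` of the layer `(s, α, β, d)`. -/
def goldenLayerVector (l : (ℤ × ℤ) × (ℤ × ℤ) × (ℤ × ℤ) × (ℤ × ℤ)) (w w' : Fin 3 → ℤ × ℤ) :
    Fin 4 → ℤ × ℤ :=
  Fin.cons l.1 fun i => goldenMul l.2.1 (w i) + goldenMul l.2.2.1 (w' i)

theorem icosahedron_seed_cases : ∀ σ : Equiv.Perm (Fin 3), Equiv.Perm.sign σ = 1 →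
    ∀ ε : Fin 3 → ℤˣ, ∃ (k : Fin 3) (s t : ℤˣ), ∀ i,
      ((ε i : ℤ) * (![(0, 1), (1, 0), (0, 0)] (σ i) : ℤ × ℤ).1,
        (ε i : ℤ) * (![(0, 1), (1, 0), (0, 0)] (σ i) : ℤ × ℤ).2) = goldenIcosahedron k s t i := by
  decide +kernel

/-- Up to signs, every vertex of the 600-cell lies in one of the layers. The second clause follows
from the last one; it shortens the search. -/
theorem exists_layer_seed : ∀ (m : Fin 3) (σ : Equiv.Perm (Fin 4)), Equiv.Perm.sign σ = 1 →
    ∃ l ∈ goldenLayers, goldenSeed m (σ 0) = l.1 ∧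
      ∃ (k : Fin 3) (s t : ℤˣ) (k' : Fin 3) (s' t' : ℤˣ),
        goldenDot (goldenIcosahedron k s t) (goldenIcosahedron k' s' t') = l.2.2.2 ∧
        ∀ i, goldenSeed m (σ i) =
          goldenLayerVector l (goldenIcosahedron k s t) (goldenIcosahedron k' s' t') i := by
  decide +kernel

/-- Up to signs, which can be chosen to be trivial in the first vertex of the icosahedron, every
vector of a layer is a vertex of the 600-cell. -/
theorem layer_seed_subset : ∀ l ∈ goldenLayers, ∀ (k k' : Fin 3) (s' t' : ℤˣ),
    goldenDot (goldenIcosahedron k 1 1) (goldenIcosahedron k' s' t') = l.2.2.2 →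
      ∃ (m : Fin 3) (σ : Equiv.Perm (Fin 4)), (∀ i,
        goldenLayerVector l (goldenIcosahedron k 1 1) (goldenIcosahedron k' s' t') i =
          goldenSeed m (σ i) ∨
        goldenLayerVector l (goldenIcosahedron k 1 1) (goldenIcosahedron k' s' t') i =
          -goldenSeed m (σ i)) ∧ Equiv.Perm.sign σ = 1 := by
  decide +kernel

theorem neg_layer : ∀ l ∈ goldenLayers, (-l.1, l.2) ∈ goldenLayers := by decide

noncomputable section

theorem evalGolden_mul (x y : ℤ × ℤ) :
    evalGolden (goldenMul x y) = evalGolden x * evalGolden y := by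
  simp only [evalGolden, goldenMul]
  push_cast
  linear_combination -(x.2 * y.2 : ℝ) * Real.goldenRatio_sq

/-- The real vector given by a vector with coordinates in `ℤ[φ]`. -/
def evalVector {n : ℕ} (x : Fin n → ℤ × ℤ) (i : Fin n) : ℝ := evalGolden (x i)

theorem evalVector_dotProduct (x y : Fin 3 → ℤ × ℤ) :
    evalVector x ⬝ᵥ evalVector y = evalGolden (goldenDot x y) := by
  simp only [dotProduct, Fin.sum_univ_three, goldenDot, evalGolden_add, evalGolden_mul, evalVector]

theorem evalVector_mem_icosahedron (k : Fin 3) (s t : ℤˣ) :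
    evalVector (goldenIcosahedron k s t) ∈ icosahedron := by
  fin_cases k
  · convert mem_icosahedron₀ s t using 1
    ext i; fin_cases i <;> simp [evalVector, goldenIcosahedron, evalGolden]
  · convert mem_icosahedron₁ s t using 1
    ext i; fin_cases i <;> simp [evalVector, goldenIcosahedron, evalGolden]
  · convert mem_icosahedron₂ s t using 1
    ext i; fin_cases i <;> simp [evalVector, goldenIcosahedron, evalGolden]

theorem exists_of_mem_icosahedron {w : Fin 3 → ℝ} (hw : w ∈ icosahedron) :
    ∃ (k : Fin 3) (s t : ℤˣ), w = evalVector (goldenIcosahedron k s t) := by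
  obtain ⟨σ, ε, hσ, hv⟩ := hw
  obtain ⟨k, s, t, h⟩ := icosahedron_seed_cases σ hσ ε
  refine ⟨k, s, t, funext fun i => ?_⟩
  rw [evalVector, ← h i, hv i]
  generalize σ i = j
  fin_cases j <;> simp [evalGolden]

/-- Changes of signs of the coordinates. -/
def flip {n : ℕ} (δ : Fin n → ℤˣ) (w : Fin n → ℝ) (i : Fin n) : ℝ := ((δ i : ℤ) : ℝ) * w i

theorem unit_mul_self (s : ℤˣ) : ((s : ℤ) : ℝ) * ((s : ℤ) : ℝ) = 1 := by
  rcases Int.units_eq_one_or s with h | h <;> simp [h]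

theorem flip_flip {n : ℕ} (δ : Fin n → ℤˣ) (w : Fin n → ℝ) : flip δ (flip δ w) = w := by
  ext i
  simp only [flip]
  rw [← mul_assoc, unit_mul_self, one_mul]

theorem flip_dotProduct {n : ℕ} (δ : Fin n → ℤˣ) (v w : Fin n → ℝ) :
    flip δ v ⬝ᵥ flip δ w = v ⬝ᵥ w := by
  refine Finset.sum_congr rfl fun i _ => ?_
  simp only [flip]
  linear_combination v i * w i * unit_mul_self (δ i)

theorem flip_mem {n : ℕ} (δ : Fin n → ℤˣ) {v w : Fin n → ℝ} (hv : v ∈ evenSignedPerms w) :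
    flip δ v ∈ evenSignedPerms w := by
  obtain ⟨σ, ε, hσ, hv⟩ := hv
  exact ⟨σ, fun i => δ i * ε i, hσ, fun i => by simp [flip, hv i, mul_assoc]⟩

theorem mem_evenSignedPerms_of_cases {n : ℕ} {v w : Fin n → ℝ} {σ : Equiv.Perm (Fin n)}
    (hσ : Equiv.Perm.sign σ = 1) (h : ∀ i, v i = w (σ i) ∨ v i = -w (σ i)) :
    v ∈ evenSignedPerms w := by
  have : ∀ i, ∃ s : ℤˣ, v i = ((s : ℤ) : ℝ) * w (σ i) := fun i => by
    rcases h i with h | h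
    · exact ⟨1, by simp [h]⟩
    · exact ⟨-1, by simp [h]⟩
  choose ε hε using this
  exact ⟨σ, ε, hσ, hε⟩

theorem mem_sixHundredCell_iff_seed {v : Fin 4 → ℝ} : v ∈ sixHundredCell ↔
    ∃ m : Fin 3, v ∈ evenSignedPerms fun i => evalGolden (goldenSeed m i) / 2 := by
  have e0 : (![1, 0, 0, 0] : Fin 4 → ℝ) = fun i => evalGolden (goldenSeed 0 i) / 2 := by
    ext i; fin_cases i <;> simp [goldenSeed, evalGolden]
  have e1 : (![1 / 2, 1 / 2, 1 / 2, 1 / 2] : Fin 4 → ℝ) =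
      fun i => evalGolden (goldenSeed 1 i) / 2 := by
    ext i; fin_cases i <;> simp [goldenSeed, evalGolden]
  have e2 : (![φ / 2, 1 / 2, φ⁻¹ / 2, 0] : Fin 4 → ℝ) =
      fun i => evalGolden (goldenSeed 2 i) / 2 := by
    have h : φ⁻¹ = -1 + φ := by
      rw [Real.inv_goldenRatio]; linarith [Real.goldenRatio_add_goldenConj]
    ext i; fin_cases i
    · simp [goldenSeed, evalGolden]
    · simp [goldenSeed, evalGolden]
    · change φ⁻¹ / 2 = evalGolden (-1, 1) / 2
      rw [h, evalGolden]; push_cast; ring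
    · simp [goldenSeed, evalGolden]
  rw [sixHundredCell, e0, e1, e2]
  simp [Fin.exists_fin_succ, or_assoc]

theorem flip_mem_sixHundredCell (δ : Fin 4 → ℤˣ) {v : Fin 4 → ℝ} (hv : v ∈ sixHundredCell) :
    flip δ v ∈ sixHundredCell := by
  obtain ⟨m, hm⟩ := mem_sixHundredCell_iff_seed.1 hv
  exact mem_sixHundredCell_iff_seed.2 ⟨m, flip_mem δ hm⟩

/-- The vertex of the 600-cell in the layer `l` given by two vertices of the icosahedron. -/
def layerVector (l : (ℤ × ℤ) × (ℤ × ℤ) × (ℤ × ℤ) × (ℤ × ℤ)) (w w' : Fin 3 → ℝ) : Fin 4 → ℝ :=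
  Fin.cons (evalGolden l.1 / 2) ((evalGolden l.2.1 / 2) • w + (evalGolden l.2.2.1 / 2) • w')

theorem layerVector_eval (l : (ℤ × ℤ) × (ℤ × ℤ) × (ℤ × ℤ) × (ℤ × ℤ)) (w w' : Fin 3 → ℤ × ℤ)
    (i : Fin 4) : layerVector l (evalVector w) (evalVector w') i =
      evalGolden (goldenLayerVector l w w' i) / 2 := by
  refine Fin.cases rfl (fun i => ?_) i
  simp only [layerVector, goldenLayerVector, Fin.cons_succ, evalGolden_add, evalGolden_mul,
    Pi.add_apply, Pi.smul_apply, smul_eq_mul, evalVector]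
  ring

theorem flip_layerVector (l : (ℤ × ℤ) × (ℤ × ℤ) × (ℤ × ℤ) × (ℤ × ℤ)) (w w' : Fin 3 → ℝ)
    (δ : Fin 3 → ℤˣ) : flip (Fin.cons 1 δ) (layerVector l w w') =
      layerVector l (flip δ w) (flip δ w') := by
  ext i
  refine Fin.cases (by simp [flip, layerVector]) (fun i => ?_) i
  simp only [flip, layerVector, Fin.cons_succ, Pi.add_apply, Pi.smul_apply, smul_eq_mul]
  ring

/-- The vertices of the 600-cell are described by the metric geometry of the icosahedron. -/
theorem mem_sixHundredCell_iff_layer {v : Fin 4 → ℝ} : v ∈ sixHundredCell ↔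
    ∃ l ∈ goldenLayers, ∃ w ∈ icosahedron, ∃ w' ∈ icosahedron,
      w ⬝ᵥ w' = evalGolden l.2.2.2 ∧ v = layerVector l w w' := by
  constructor
  · intro hv
    obtain ⟨m, σ, ε, hσ, hv⟩ := mem_sixHundredCell_iff_seed.1 hv
    obtain ⟨l, hl, -, k, s, t, k', s', t', hd, h⟩ := exists_layer_seed m σ hσ
    have key : ∀ l' : (ℤ × ℤ) × (ℤ × ℤ) × (ℤ × ℤ) × (ℤ × ℤ), l' ∈ goldenLayers →
        l'.2 = l.2 → evalGolden l'.1 = ((ε 0 : ℤ) : ℝ) * evalGolden l.1 →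
        ∃ l ∈ goldenLayers, ∃ w ∈ icosahedron, ∃ w' ∈ icosahedron,
          w ⬝ᵥ w' = evalGolden l.2.2.2 ∧ v = layerVector l w w' := by
      intro l' hl' h2 h1
      refine ⟨l', hl', _, flip_mem (Fin.tail ε) (evalVector_mem_icosahedron k s t), _,
        flip_mem (Fin.tail ε) (evalVector_mem_icosahedron k' s' t'), ?_, ?_⟩
      · rw [flip_dotProduct, evalVector_dotProduct, hd, h2]
      · rw [← flip_layerVector]
        ext i
        have hi := layerVector_eval l (goldenIcosahedron k s t) (goldenIcosahedron k' s' t') i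
        rw [← h i] at hi
        rw [hv i]
        beta_reduce
        rw [← hi]
        refine Fin.cases ?_ (fun i => ?_) i
        · simp only [flip, layerVector, Fin.cons_zero, h1]
          simp; ring
        · simp only [flip, layerVector, Fin.cons_succ, h2]
          rfl
    rcases Int.units_eq_one_or (ε 0) with h0 | h0
    · exact key l hl rfl (by simp [h0])
    · exact key _ (neg_layer l hl) rfl (by simp [h0, evalGolden_neg])
  · rintro ⟨l, hl, w, hw, w', hw', hd, rfl⟩
    obtain ⟨δ, k, hδ⟩ : ∃ (δ : Fin 3 → ℤˣ) (k : Fin 3),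
        flip δ w = evalVector (goldenIcosahedron k 1 1) := by
      obtain ⟨k, s, t, rfl⟩ := exists_of_mem_icosahedron hw
      refine ⟨fun i => if i = k then s else t, k, funext fun i => ?_⟩
      simp only [flip, evalVector, goldenIcosahedron]
      split_ifs
      · simp only [evalGolden]; push_cast; linear_combination φ * unit_mul_self s
      · simp only [evalGolden]; push_cast; linear_combination unit_mul_self t
      · simp [evalGolden]
    obtain ⟨k', s', t', hw2⟩ := exists_of_mem_icosahedron (flip_mem δ hw')
    rw [← flip_dotProduct δ, hδ, hw2, evalVector_dotProduct] at hd
    obtain ⟨m, σ, hσ, hσ'⟩ := layer_seed_subset l hl k k' s' t' (evalGolden_injective hd)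
    rw [← flip_flip (Fin.cons 1 δ) (layerVector l w w'), flip_layerVector, hδ, hw2]
    refine flip_mem_sixHundredCell _ (mem_sixHundredCell_iff_seed.2 ⟨m, ?_⟩)
    refine mem_evenSignedPerms_of_cases hσ' fun i => ?_
    rw [layerVector_eval]
    rcases hσ i with h | h
    · exact Or.inl (by rw [h])
    · exact Or.inr (by rw [h, evalGolden_neg, neg_div])

/-- A symmetry of the icosahedron extends to a symmetry of the 600-cell. -/
theorem cons_mem_sixHundredCell {A : (Fin 3 → ℝ) → Fin 3 → ℝ}
    (hA : ∀ x y, A x ⬝ᵥ A y = x ⬝ᵥ y) (hI : ∀ w ∈ icosahedron, A w ∈ icosahedron)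
    {v : Fin 4 → ℝ} (hv : v ∈ sixHundredCell) :
    (Fin.cons (v 0) (A (Fin.tail v)) : Fin 4 → ℝ) ∈ sixHundredCell := by
  obtain ⟨l, hl, w, hw, w', hw', hd, rfl⟩ := mem_sixHundredCell_iff_layer.1 hv
  refine mem_sixHundredCell_iff_layer.2 ⟨l, hl, _, hI w hw, _, hI w' hw', by rw [hA, hd], ?_⟩
  simp only [layerVector, Fin.cons_zero, Fin.tail_cons]
  rw [combination_of_preserves_dotProduct hA]

/-! ### Extension of symmetries of the dodecahedron to the 120-cell -/

theorem extend_space_zero {g : HypIsometry 3} (hg : g (origin 3) = origin 3) (z : Hyp 4) :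
    (extend g z).space 0 = z.space 0 := by
  conv_rhs => rw [← fermi_proj z]
  rw [extend_apply, fermi_space_zero, fermi_space_zero, time_map hg]

theorem extend_time {g : HypIsometry 3} (hg : g (origin 3) = origin 3) (z : Hyp 4) :
    (extend g z).time = z.time := by
  conv_rhs => rw [← fermi_proj z]
  rw [extend_apply, fermi_time, fermi_time, time_map hg]

theorem extend_tail {g : HypIsometry 3} (hg : g (origin 3) = origin 3) (z : Hyp 4) :
    Fin.tail (extend g z).space = spatial g (Fin.tail z.space) := by
  have hlin := combination_of_preserves_dotProduct (spatial_dotProduct hg)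
    (√(1 + height z ^ 2)) 0 (proj z).space 0
  conv_rhs => rw [← fermi_proj z]
  rw [extend_apply, fermi_tail, fermi_tail, spatial_space]
  simpa using hlin.symm

theorem extend_mem_cell120 {g : HypIsometry 3} (hg : g '' dodecahedron = dodecahedron) {z : Hyp 4}
    (hz : z ∈ cell120) : extend g z ∈ cell120 := by
  intro v hv
  have hg' := g.inv_image hg
  have h := hz _ (cons_mem_sixHundredCell (spatial_dotProduct (map_origin hg'))
    (fun w hw => spatial_mem_icosahedron hg' hw) hv)
  rw [dotProduct_four, Fin.cons_zero, Fin.tail_cons, ← spatial_dotProduct (map_origin hg),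
    spatial_inv] at h
  rw [dotProduct_four, extend_space_zero (map_origin hg), extend_tail (map_origin hg),
    extend_time (map_origin hg)]
  exact h

/-- Every symmetry of the dodecahedron extends to a symmetry of the 120-cell. -/
theorem isExtension_extend {g : HypIsometry 3} (hg : g '' dodecahedron = dodecahedron) :
    DodecahedralGluing.IsExtension g (extend g) := by
  refine ⟨Set.Subset.antisymm ?_ fun z hz => ?_, fun z => ?_⟩
  · rintro _ ⟨z, hz, rfl⟩
    exact extend_mem_cell120 hg hz
  · refine ⟨extend g.inv z, extend_mem_cell120 (g.inv_image hg) hz, ?_⟩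
    simp [extend_apply]
  · rw [← fermi_zero, ← fermi_zero, extend_fermi]

/-- The extension is unique on the 120-cell. -/
theorem eq_extend_of_isExtension {g : HypIsometry 3} {G : HypIsometry 4}
    (hG : DodecahedralGluing.IsExtension g G) {z : Hyp 4} (hz : z ∈ cell120) :
    G z = extend g z :=
  eq_extend_of_height_nonneg hG.2 (height_nonneg hz) (height_nonneg (hG.1 ▸ ⟨z, hz, rfl⟩))

/-! ### The topology of the glued spaces -/

theorem isOpen_prod_discrete_iff {X D : Type*} [TopologicalSpace X] [TopologicalSpace D]
    [DiscreteTopology D] {s : Set (X × D)} : IsOpen s ↔ ∀ d, IsOpen {x | (x, d) ∈ s} := by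
  constructor
  · intro h d
    exact h.preimage (Continuous.prodMk_left d)
  · intro h
    rw [isOpen_prod_iff]
    intro a b hab
    refine ⟨_, {b}, h b, isOpen_discrete _, hab, rfl, ?_⟩
    rintro ⟨x, y⟩ ⟨hx, rfl⟩
    exact hx

/-- The projection of the 120-cell to the dodecahedron. -/
def cellProj (x : cell120) : dodecahedron := ⟨proj x.1, proj_mem_dodecahedron x.2⟩

theorem continuous_cellProj : Continuous cellProj :=
  (continuous_proj.comp continuous_subtype_val).subtype_mk _

/-- The point of the 120-cell over a point of the dodecahedron, at a height truncated so that it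
stays in the product neighbourhood of the base facet. -/
def cellLift (x : dodecahedron) (s : ℝ) : cell120 :=
  ⟨fermi x.1 (min |s| (1 / 20)), fermi_mem_cell120 x.2 (le_min (abs_nonneg s) (by norm_num))
    ((min_le_right _ _).trans (by norm_num))⟩

theorem continuous_cellLift : Continuous fun x : dodecahedron × ℝ => cellLift x.1 x.2 := by
  refine Continuous.subtype_mk (continuous_fermi.comp (Continuous.prodMk ?_ ?_)) _
  · exact continuous_subtype_val.comp continuous_fst
  · fun_prop

@[simp] theorem cellProj_cellLift (x : dodecahedron) (s : ℝ) : cellProj (cellLift x s) = x :=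
  Subtype.ext (proj_fermi _ _)

theorem height_cellLift (x : dodecahedron) (s : ℝ) :
    height (cellLift x s).1 = min |s| (1 / 20) := height_fermi _ _

theorem cellLift_cellProj (x : cell120) {s : ℝ} (hs : |s| = height x.1) (hs' : |s| ≤ 1 / 20) :
    cellLift (cellProj x) s = x := by
  refine Subtype.ext ?_
  change fermi (proj x.1) (min |s| (1 / 20)) = x.1
  rw [min_eq_left hs', hs, fermi_proj]

namespace DodecahedralGluing

variable {ι : Type*} (T : DodecahedralGluing ι)

theorem isQuotientMap_cell :
    IsQuotientMap (fun y : Σ _ : ι, dodecahedron => T.cell y.1 y.2) :=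
  isQuotientMap_quot_mk

theorem continuous_cell (i : ι) : Continuous (T.cell i) :=
  T.isQuotientMap_cell.continuous.comp continuous_sigmaMk

theorem cell_surjective (m : T.Space) : ∃ i x, T.cell i x = m := by
  obtain ⟨y, rfl⟩ := T.isQuotientMap_cell.surjective m
  exact ⟨y.1, y.2, rfl⟩

theorem isOpen_half_iff {s : Set T.Half} : IsOpen s ↔ ∀ i, IsOpen (T.halfCell i ⁻¹' s) := by
  have h : IsQuotientMap (Quot.mk T.CornerRel : _ → T.Half) := isQuotientMap_quot_mk
  exact h.isOpen_preimage.symm.trans isOpen_sigma_iff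

theorem isOpen_mirror_iff {s : Set T.Mirror} :
    IsOpen s ↔ ∀ b i, IsOpen (T.mirrorCell b i ⁻¹' s) := by
  have h : IsQuotientMap (Quot.mk T.MirrorRel : _ → T.Mirror) := isQuotientMap_quot_mk
  refine h.isOpen_preimage.symm.trans ?_
  rw [← (Homeomorph.prodComm T.Half Bool).isOpen_preimage, isOpen_prod_discrete_iff]
  exact forall_congr' fun b => T.isOpen_half_iff

variable {k : ℕ} (c : T.Facet → Fin k)

theorem isOpen_coloured_iff {s : Set (T.Coloured c)} :
    IsOpen s ↔ ∀ j, IsOpen (T.colouredCell c j ⁻¹' s) := by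
  have h : IsQuotientMap (Quot.mk (T.ColourRel c) : _ → T.Coloured c) := isQuotientMap_quot_mk
  refine h.isOpen_preimage.symm.trans (isOpen_prod_discrete_iff.trans ?_)
  constructor
  · rintro h ⟨b, i, u⟩
    exact T.isOpen_mirror_iff.1 (h u) b i
  · intro h u
    exact T.isOpen_mirror_iff.2 fun b i => h (b, i, u)

theorem continuous_colouredCell (j : Bool × ι × (Fin k → ZMod 2)) :
    Continuous (T.colouredCell c j) :=
  continuous_def.2 fun _ hs => (T.isOpen_coloured_iff c).1 hs j

variable {T c} in
theorem continuous_of_colouredCell {Y : Type*} [TopologicalSpace Y] {f : T.Coloured c → Y}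
    (h : ∀ j, Continuous fun x => f (T.colouredCell c j x)) : Continuous f :=
  continuous_def.2 fun _ hs => (T.isOpen_coloured_iff c).2 fun j => hs.preimage (h j)

theorem colouredCell_surjective (n : T.Coloured c) : ∃ j x, T.colouredCell c j x = n := by
  obtain ⟨⟨p, u⟩, rfl⟩ := Quot.exists_rep n
  obtain ⟨⟨b, q⟩, rfl⟩ := Quot.exists_rep p
  obtain ⟨⟨i, x⟩, rfl⟩ := Quot.exists_rep q
  exact ⟨(b, i, u), x, rfl⟩

/-! ### The gluing maps in Fermi coordinates -/

variable {T} in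
theorem CornerRel.height_eq {y z : Σ _ : ι, cell120} (h : T.CornerRel y z) :
    height y.2.1 = height z.2.1 := by
  obtain ⟨i, w, G, x, y, hG, hx, hy⟩ := h
  simp only
  rw [hy, eq_extend_of_isExtension hG x.2, extend_apply, height_fermi]

variable {T} in
theorem CornerRel.cell_eq {y z : Σ _ : ι, cell120} (h : T.CornerRel y z) :
    T.cell y.1 (cellProj y.2) = T.cell z.1 (cellProj z.2) := by
  obtain ⟨i, w, G, x, y, hG, hx, hy⟩ := h
  refine Quot.sound (Rel.glue i w _ _ (mem_sideFacet_iff.1 hx).2 ?_)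
  change proj y.1 = _
  rw [hy, eq_extend_of_isExtension hG x.2, extend_apply, proj_fermi]
  rfl

/-- The projection of `W'` to `M`. -/
def halfProj : T.Half → T.Space :=
  Quot.lift (fun y => T.cell y.1 (cellProj y.2)) fun _ _ h => h.cell_eq

/-- The height of points of `W'` over `M`. -/
def halfHeight : T.Half → ℝ := Quot.lift (fun y => height y.2.1) fun _ _ h => h.height_eq

theorem halfHeight_of_mem_base {p : T.Half} (hp : p ∈ T.baseOfHalf) : T.halfHeight p = 0 := by
  obtain ⟨i, x, hx, rfl⟩ := hp
  exact (mem_baseFacet_iff.1 hx).2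

/-- The projection of `W` to `M`. -/
def mirrorProj : T.Mirror → T.Space :=
  Quot.lift (fun q => T.halfProj q.2) (by rintro _ _ ⟨b, b', p, -⟩; rfl)

/-- The signed height of points of `W` over `M`: positive in the copy `true` of `W'`, negative in
the copy `false`. -/
def mirrorHeight : T.Mirror → ℝ :=
  Quot.lift (fun q => cond q.1 (T.halfHeight q.2) (-T.halfHeight q.2)) (by
    rintro _ _ ⟨b, b', p, hp⟩
    cases b <;> cases b' <;> simp [T.halfHeight_of_mem_base hp])

/-- The facets of `W` are far from `M`, so the gluing of the copies of `W` does not affect the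
collar of `M`. -/
theorem lt_abs_mirrorHeight {F : T.Facet} {p : T.Mirror} (hp : p ∈ T.facetSet F) :
    1 / 10 < |T.mirrorHeight p| := by
  obtain ⟨f, x, -, hx, rfl⟩ := hp
  have h := height_of_mem_free_facet f.2.1.2 f.2.2 hx
  change 1 / 10 < |cond F.1 (height x.1) (-height x.1)|
  rw [lt_abs]
  cases F.1
  · exact Or.inr (by simpa using h)
  · exact Or.inl h

/-- The projection of `N` to `M`. -/
def colouredProj : T.Coloured c → T.Space :=
  Quot.lift (fun q => T.mirrorProj q.1) (by rintro _ _ ⟨F, p, u, v, -, -⟩; rfl)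

/-- The signed height of points of `N`. -/
def colouredHeight : T.Coloured c → ℝ :=
  Quot.lift (fun q => T.mirrorHeight q.1) (by rintro _ _ ⟨F, p, u, v, -, -⟩; rfl)

/-- The index in `ℤ₂ᵏ` of the copy of `W` to which a point of `N` near `M × ℤ₂ᵏ` belongs (and `0`
for the points far from it). -/
def colouredIndex : T.Coloured c → (Fin k → ZMod 2) :=
  Quot.lift (fun q => if |T.mirrorHeight q.1| ≤ 1 / 10 then q.2 else 0) (by
    rintro _ _ ⟨F, p, u, v, hp, -⟩
    have := T.lt_abs_mirrorHeight hp
    simp only [if_neg (not_le.2 this)])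

@[simp] theorem colouredProj_cell (j : Bool × ι × (Fin k → ZMod 2)) (x : cell120) :
    T.colouredProj c (T.colouredCell c j x) = T.cell j.2.1 (cellProj x) := rfl

@[simp] theorem colouredHeight_cell (j : Bool × ι × (Fin k → ZMod 2)) (x : cell120) :
    T.colouredHeight c (T.colouredCell c j x) = cond j.1 (height x.1) (-height x.1) := rfl

theorem abs_colouredHeight_cell (j : Bool × ι × (Fin k → ZMod 2)) (x : cell120) :
    |T.colouredHeight c (T.colouredCell c j x)| = height x.1 := by
  rw [colouredHeight_cell]
  cases j.1
  · simp [abs_of_nonneg (height_nonneg x.2)]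
  · simp [abs_of_nonneg (height_nonneg x.2)]

theorem colouredIndex_cell (j : Bool × ι × (Fin k → ZMod 2)) {x : cell120}
    (hx : height x.1 ≤ 1 / 10) : T.colouredIndex c (T.colouredCell c j x) = j.2.2 := by
  rw [← T.abs_colouredHeight_cell c j] at hx
  exact if_pos hx

theorem continuous_colouredProj : Continuous (T.colouredProj c) :=
  continuous_of_colouredCell fun j => (T.continuous_cell j.2.1).comp continuous_cellProj

theorem continuous_colouredHeight : Continuous (T.colouredHeight c) := by
  have h : Continuous fun x : cell120 => height x.1 := continuous_height.comp continuous_subtype_val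
  refine continuous_of_colouredCell fun ⟨b, i, u⟩ => ?_
  cases b
  · exact h.neg
  · exact h

/-- The collar of `M × {u}` in `N`. -/
def collar (u : Fin k → ZMod 2) : Set (T.Coloured c) :=
  {n | |T.colouredHeight c n| < 1 / 20 ∧ T.colouredIndex c n = u}

theorem isOpen_collar (u : Fin k → ZMod 2) : IsOpen (T.collar c u) := by
  have h : IsOpen {x : cell120 | height x.1 < 1 / 20} :=
    isOpen_lt (continuous_height.comp continuous_subtype_val) continuous_const
  refine (T.isOpen_coloured_iff c).2 fun j => ?_
  by_cases hj : j.2.2 = u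
  · convert h using 1
    ext x
    simp only [collar, Set.mem_preimage, Set.mem_ofPred_eq, abs_colouredHeight_cell]
    refine and_iff_left_of_imp fun hx => ?_
    rw [T.colouredIndex_cell c j (by linarith), hj]
  · convert isOpen_empty using 1
    ext x
    simp only [collar, Set.mem_preimage, Set.mem_ofPred_eq, abs_colouredHeight_cell,
      Set.mem_empty_iff_false, iff_false]
    rintro ⟨hx, h2⟩
    rw [T.colouredIndex_cell c j (by linarith)] at h2
    exact hj h2

/-- The two copies of `W'` are glued along the base facets. -/
theorem colouredCell_glue_base (b b' : Bool) (i : ι) (u : Fin k → ZMod 2) {x : cell120}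
    (hx : height x.1 = 0) : T.colouredCell c (b, i, u) x = T.colouredCell c (b', i, u) x := by
  have : T.mirrorCell b i x = T.mirrorCell b' i x :=
    Quot.sound (MirrorRel.glue b b' _ ⟨i, x, mem_baseFacet_iff.2 ⟨x.2, hx⟩, rfl⟩)
  exact congrArg (fun p => (Quot.mk _ (p, u) : T.Coloured c)) this

variable {T} in
/-- The gluing of the dodecahedra extends to the product neighbourhood of the base facets. -/
theorem Rel.colouredCell_eq {y z : Σ _ : ι, dodecahedron} (h : T.Rel y z) (b : Bool)
    (u : Fin k → ZMod 2) (s : ℝ) : T.colouredCell c (b, y.1, u) (cellLift y.2 s) =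
      T.colouredCell c (b, z.1, u) (cellLift z.2 s) := by
  obtain ⟨i, w, x, y, hx, hy⟩ := h
  have h : T.halfCell i (cellLift x s) = T.halfCell (T.pair (i, w)).1 (cellLift y s) := by
    refine Quot.sound (CornerRel.glue i w _ _ _ (isExtension_extend (T.symm_image _)) ?_ ?_)
    · exact mem_sideFacet_iff.2 ⟨(cellLift x s).2, by
        change proj (fermi _ _) ∈ _
        rwa [proj_fermi]⟩
    · change fermi _ _ = extend _ (fermi _ _)
      rw [extend_fermi, hy]
  exact congrArg (fun p => (Quot.mk _ (Quot.mk _ (b, p), u) : T.Coloured c)) h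

/-- The inverse of the Fermi coordinates of the collar of `M × {u}`. -/
def collarMap (u : Fin k → ZMod 2) (q : T.Space × ℝ) : T.Coloured c :=
  Quot.lift (fun y : Σ _ : ι, dodecahedron =>
    T.colouredCell c (decide (0 ≤ q.2), y.1, u) (cellLift y.2 q.2))
    (fun _ _ h => h.colouredCell_eq c _ u q.2) q.1

theorem collarMap_cell (u : Fin k → ZMod 2) (i : ι) (x : dodecahedron) (s : ℝ) :
    T.collarMap c u (T.cell i x, s) = T.colouredCell c (decide (0 ≤ s), i, u) (cellLift x s) := rfl

theorem continuous_collarMap (u : Fin k → ZMod 2) : Continuous (T.collarMap c u) := by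
  refine T.isQuotientMap_cell.continuous_lift_prod_left ?_
  rw [← Homeomorph.sigmaProdDistrib.symm.comp_continuous_iff', continuous_sigma_iff]
  intro i
  change Continuous fun p : dodecahedron × ℝ =>
    T.colouredCell c (decide (0 ≤ p.2), i, u) (cellLift p.1 p.2)
  have h : ∀ b, Continuous fun p : dodecahedron × ℝ =>
      T.colouredCell c (b, i, u) (cellLift p.1 p.2) := fun b =>
    (T.continuous_colouredCell c _).comp continuous_cellLift
  have h2 := Continuous.if_le (h true) (h false) continuous_const continuous_snd (f := fun _ => 0)
    fun p hp => T.colouredCell_glue_base c true false i u (by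
      rw [height_cellLift, ← hp]; simp)
  convert h2 using 2 with p
  split_ifs with hp <;> simp [hp]

@[simp] theorem colouredProj_collarMap (u : Fin k → ZMod 2) (q : T.Space × ℝ) :
    T.colouredProj c (T.collarMap c u q) = q.1 := by
  obtain ⟨m, s⟩ := q
  obtain ⟨i, x, rfl⟩ := T.cell_surjective m
  rw [collarMap_cell, colouredProj_cell, cellProj_cellLift]

theorem colouredHeight_collarMap (u : Fin k → ZMod 2) {q : T.Space × ℝ} (hq : |q.2| ≤ 1 / 20) :
    T.colouredHeight c (T.collarMap c u q) = q.2 := by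
  obtain ⟨m, s⟩ := q
  obtain ⟨i, x, rfl⟩ := T.cell_surjective m
  rw [collarMap_cell, colouredHeight_cell, height_cellLift, min_eq_left hq]
  rcases le_or_gt 0 s with h | h
  · simp [h, abs_of_nonneg h]
  · simp [not_le.2 h, abs_of_neg h]

@[simp] theorem colouredIndex_collarMap (u : Fin k → ZMod 2) (q : T.Space × ℝ) :
    T.colouredIndex c (T.collarMap c u q) = u := by
  obtain ⟨m, s⟩ := q
  obtain ⟨i, x, rfl⟩ := T.cell_surjective m
  rw [collarMap_cell, colouredIndex_cell]
  rw [height_cellLift]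
  exact (min_le_right _ _).trans (by norm_num)

theorem collarMap_of_mem_collar {u : Fin k → ZMod 2} {n : T.Coloured c} (hn : n ∈ T.collar c u) :
    T.collarMap c u (T.colouredProj c n, T.colouredHeight c n) = n := by
  obtain ⟨hn, rfl⟩ := hn
  obtain ⟨⟨b, i, v⟩, x, rfl⟩ := T.colouredCell_surjective c n
  have ha := T.abs_colouredHeight_cell c (b, i, v) x
  rw [colouredIndex_cell _ _ _ (by rw [← ha]; linarith), colouredProj_cell, collarMap_cell,
    cellLift_cellProj x ha hn.le]
  have h0 := height_nonneg x.2
  rcases h0.eq_or_lt with h | h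
  · exact T.colouredCell_glue_base c _ _ i v h.symm
  · congr
    cases b
    · simpa using h
    · exact decide_eq_true h0

/-! ### The embedding of `M × ℤ₂ᵏ` -/

/-- The map `M × ℤ₂ᵏ → N` induced by the inclusion of `M` in `W`. -/
def baseMap (p : T.Space × (Fin k → ZMod 2)) : T.Coloured c := T.collarMap c p.2 (p.1, 0)

theorem baseMap_cell (i : ι) (x : dodecahedron) (u : Fin k → ZMod 2) (b : Bool) :
    T.baseMap c (T.cell i x, u) = T.colouredCell c (b, i, u) (baseInclusion x) := by
  have h : cellLift x 0 = baseInclusion x := Subtype.ext (by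
    change fermi x.1 (min |0| (1 / 20)) = incl x.1
    rw [← fermi_zero]; norm_num)
  rw [baseMap, collarMap_cell, h]
  refine T.colouredCell_glue_base c _ _ i u ?_
  change height (incl x.1) = 0
  rw [← fermi_zero, height_fermi]

@[simp] theorem colouredProj_baseMap (p : T.Space × (Fin k → ZMod 2)) :
    T.colouredProj c (T.baseMap c p) = p.1 := T.colouredProj_collarMap c _ _

@[simp] theorem colouredIndex_baseMap (p : T.Space × (Fin k → ZMod 2)) :
    T.colouredIndex c (T.baseMap c p) = p.2 := T.colouredIndex_collarMap c _ _

@[simp] theorem colouredHeight_baseMap (p : T.Space × (Fin k → ZMod 2)) :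
    T.colouredHeight c (T.baseMap c p) = 0 := T.colouredHeight_collarMap c _ (by norm_num)

theorem baseMap_mem_collar (p : T.Space × (Fin k → ZMod 2)) : T.baseMap c p ∈ T.collar c p.2 :=
  ⟨by rw [colouredHeight_baseMap]; norm_num, T.colouredIndex_baseMap c p⟩

theorem mem_range_baseMap_iff {n : T.Coloured c} :
    n ∈ Set.range (T.baseMap c) ↔ T.colouredHeight c n = 0 := by
  constructor
  · rintro ⟨p, rfl⟩
    exact T.colouredHeight_baseMap c p
  · intro h
    have hn : n ∈ T.collar c (T.colouredIndex c n) := ⟨by rw [h]; norm_num, rfl⟩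
    refine ⟨(T.colouredProj c n, T.colouredIndex c n), ?_⟩
    conv_rhs => rw [← T.collarMap_of_mem_collar c hn, h]
    rfl

theorem continuous_baseMap : Continuous (T.baseMap c) := by
  refine continuous_def.2 fun s hs => isOpen_prod_discrete_iff.2 fun u => ?_
  exact hs.preimage ((T.continuous_collarMap c u).comp (Continuous.prodMk_left 0))

/-- Near the image of the map, the projection to `M` and the index in `ℤ₂ᵏ` give a continuous left
inverse. -/
theorem isEmbedding_baseMap : IsEmbedding (T.baseMap c) := by
  let r : T.Coloured c → T.Space × (Fin k → ZMod 2) :=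
    fun n => (T.colouredProj c n, T.colouredIndex c n)
  have hr : ∀ p, r (T.baseMap c p) = p := fun p => by simp [r]
  have hcont : ∀ p, ContinuousAt r (T.baseMap c p) := by
    intro p
    refine (T.continuous_colouredProj c).continuousAt.prodMk ?_
    refine (continuousAt_const (y := p.2)).congr ?_
    filter_upwards [(T.isOpen_collar c p.2).mem_nhds (T.baseMap_mem_collar c p)] with n hn
    exact hn.2.symm
  refine ⟨isInducing_iff_nhds.2 fun p => le_antisymm ?_ ?_, Function.LeftInverse.injective hr⟩
  · exact (T.continuous_baseMap c).continuousAt.tendsto.le_comap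
  · have h1 := (hcont p).tendsto.le_comap
    rw [hr] at h1
    refine (Filter.comap_mono h1).trans ?_
    rw [Filter.comap_comap, show r ∘ T.baseMap c = id from funext hr, Filter.comap_id]

/-! ### Hyperbolic charts around the image -/

variable {T}

/-- The chart of `M × {u}` given by a chart of `M`. -/
def copiesChart (e : OpenPartialHomeomorph T.Space (Hyp 3)) (u : Fin k → ZMod 2) :
    OpenPartialHomeomorph (T.Space × (Fin k → ZMod 2)) (Hyp 3) where
  toFun q := e q.1
  invFun y := (e.symm y, u)
  source := e.source ×ˢ {u}
  target := e.target
  map_source' _ hq := e.map_source hq.1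
  map_target' _ hy := ⟨e.map_target hy, rfl⟩
  left_inv' _ hq := Prod.ext (e.left_inv hq.1) hq.2.symm
  right_inv' _ hy := e.right_inv hy
  open_source := e.open_source.prod (isOpen_discrete _)
  open_target := e.open_target
  continuousOn_toFun := e.continuousOn.comp continuousOn_fst fun _ hq => hq.1
  continuousOn_invFun := e.continuousOn_symm.prodMk continuousOn_const

theorem isHyperbolicChart_copiesChart {e : OpenPartialHomeomorph T.Space (Hyp 3)}
    (he : IsHyperbolicChart T.cell e) (u : Fin k → ZMod 2) :
    IsHyperbolicChart (T.copiesCell k) (copiesChart e u) :=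
  fun j x hx => he j.1 x hx.1

/-- The chart of the collar of `M × {u}` in `N` given by a chart of `M`, in Fermi coordinates. -/
def collarChart (e : OpenPartialHomeomorph T.Space (Hyp 3)) (u : Fin k → ZMod 2) :
    OpenPartialHomeomorph (T.Coloured c) (Hyp 4) where
  toFun n := fermi (e (T.colouredProj c n)) (T.colouredHeight c n)
  invFun z := T.collarMap c u (e.symm (proj z), height z)
  source := T.collar c u ∩ T.colouredProj c ⁻¹' e.source
  target := {z | |height z| < 1 / 20} ∩ proj ⁻¹' e.target
  map_source' n hn := by
    refine ⟨?_, ?_⟩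
    · simpa using hn.1.1
    · simpa using e.map_source hn.2
  map_target' z hz := by
    refine ⟨⟨?_, T.colouredIndex_collarMap c _ _⟩, ?_⟩
    · rw [T.colouredHeight_collarMap c u hz.1.le]
      exact hz.1
    · rw [Set.mem_preimage, colouredProj_collarMap]
      exact e.map_target hz.2
  left_inv' n hn := by
    rw [proj_fermi, height_fermi, e.left_inv hn.2]
    exact T.collarMap_of_mem_collar c hn.1
  right_inv' z hz := by
    rw [T.colouredHeight_collarMap c u hz.1.le, colouredProj_collarMap, e.right_inv hz.2,
      fermi_proj]
  open_source := (T.isOpen_collar c u).inter (e.open_source.preimage (T.continuous_colouredProj c))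
  open_target := (isOpen_lt continuous_height.abs continuous_const).inter
    (e.open_target.preimage continuous_proj)
  continuousOn_toFun := by
    have h : ContinuousOn (fun n => e (T.colouredProj c n))
        (T.collar c u ∩ T.colouredProj c ⁻¹' e.source) :=
      e.continuousOn.comp (T.continuous_colouredProj c).continuousOn fun n hn => hn.2
    have h2 := continuous_fermi.comp_continuousOn
      (h.prodMk (T.continuous_colouredHeight c).continuousOn)
    exact h2
  continuousOn_invFun := by
    have h : ContinuousOn (fun z => e.symm (proj z))
        ({z | |height z| < 1 / 20} ∩ proj ⁻¹' e.target) :=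
      e.continuousOn_symm.comp continuous_proj.continuousOn fun z hz => hz.2
    have h2 := (T.continuous_collarMap c u).comp_continuousOn
      (h.prodMk continuous_height.continuousOn)
    exact h2

/-- On the two sides of `M` the chart is the extension of an isometry of `ℍ³`, preceded by the
reflection in the base hyperplane on the negative side. -/
theorem isHyperbolicChart_collarChart {e : OpenPartialHomeomorph T.Space (Hyp 3)}
    (he : IsHyperbolicChart T.cell e) (u : Fin k → ZMod 2) :
    IsHyperbolicChart (T.colouredCell c) (collarChart c e u) := by
  rintro ⟨b, i, v⟩ x hx
  obtain ⟨g, hg⟩ := he i (cellProj x) hx.2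
  have hg' := continuous_cellProj.continuousAt.eventually hg
  have key : ∀ z : cell120, e (T.cell i (cellProj z)) = g (cellProj z).1 →
      collarChart c e u (T.colouredCell c (b, i, v) z) =
        fermi (g (proj z.1)) (cond b (height z.1) (-height z.1)) := by
    intro z hz
    change fermi (e (T.cell i (cellProj z))) (cond b (height z.1) (-height z.1)) = _
    rw [hz]
    rfl
  cases b
  · refine ⟨(extend g).comp baseReflection, hg'.mono fun z hz => ?_⟩
    rw [key z hz, HypIsometry.comp_apply, baseReflection_apply, extend_fermi]
    rfl
  · refine ⟨extend g, hg'.mono fun z hz => ?_⟩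
    rw [key z hz, extend_apply]
    rfl

theorem isTotallyGeodesicEmbedding_baseMap (hM : IsHyperbolicManifold T.cell) :
    IsTotallyGeodesicEmbedding (T.copiesCell k) (T.colouredCell c) (T.baseMap c) := by
  refine ⟨T.isEmbedding_baseMap c, fun p => ?_⟩
  obtain ⟨e, he, hp⟩ := hM p.1
  have hsrc : ∀ q ∈ (copiesChart e p.2).source, T.baseMap c q ∈ (collarChart c e p.2).source := by
    rintro ⟨m, u⟩ ⟨hm, hu⟩
    obtain rfl : u = p.2 := hu
    exact ⟨T.baseMap_mem_collar c _, by simpa using hm⟩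
  have hp' : p ∈ (copiesChart e p.2).source := ⟨hp, rfl⟩
  refine ⟨copiesChart e p.2, collarChart c e p.2, isHyperbolicChart_copiesChart he _,
    isHyperbolicChart_collarChart c he _, hp', hsrc p hp', fun q hq => ⟨hsrc q hq, ?_⟩,
    fun n hn => ?_⟩
  · change fermi (e (T.colouredProj c _)) (T.colouredHeight c _) = incl (e q.1)
    rw [colouredProj_baseMap, colouredHeight_baseMap, fermi_zero]
  · rw [mem_range_baseMap_iff]
    change _ ↔ fermi (e (T.colouredProj c n)) (T.colouredHeight c n) ∈ _
    constructor
    · intro h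
      rw [h, fermi_zero]
      exact ⟨_, rfl⟩
    · rintro ⟨y, hy⟩
      rw [← fermi_zero] at hy
      simpa using (congrArg height hy).symm

/-! ### Connectedness of the two sides -/

/-- The union of the `i`-th 120-cell of the copy `true` of `W'`, over `u`, without its base facet,
and of a parallel copy of `M`. -/
def sheetPart (u : Fin k → ZMod 2) (i : ι) : Set (T.Coloured c) :=
  T.collarMap c u '' (Set.univ ×ˢ {1 / 20}) ∪ T.colouredCell c (true, i, u) '' {x | 0 < height x.1}

theorem collarMap_mem_cell (u : Fin k → ZMod 2) (i : ι) (x : dodecahedron) :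
    T.collarMap c u (T.cell i x, 1 / 20) ∈
      T.colouredCell c (true, i, u) '' {x | 0 < height x.1} := by
  refine ⟨cellLift x (1 / 20), ?_, ?_⟩
  · change 0 < height _
    rw [height_cellLift, abs_of_pos (by norm_num), min_self]
    norm_num
  · rw [collarMap_cell, decide_eq_true (by norm_num)]

theorem isPreconnected_sheet (hconn : ConnectedSpace T.Space) (u : Fin k → ZMod 2) :
    IsPreconnected (⋃ i, sheetPart c u i) := by
  have hM : IsPreconnected (T.collarMap c u '' (Set.univ ×ˢ {(1 / 20 : ℝ)})) :=
    (isPreconnected_univ.prod isPreconnected_singleton).image _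
      (T.continuous_collarMap c u).continuousOn
  obtain ⟨m⟩ := hconn.toNonempty
  refine isPreconnected_iUnion ⟨T.collarMap c u (m, 1 / 20), Set.mem_iInter.2 fun i =>
    Or.inl ⟨_, ⟨trivial, Set.mem_singleton _⟩, rfl⟩⟩ fun i => ?_
  exact hM.union (T.collarMap c u (T.cell i ⟨_, origin_mem_dodecahedron⟩, 1 / 20))
    ⟨_, ⟨trivial, Set.mem_singleton _⟩, rfl⟩ (collarMap_mem_cell c u i _)
    (isPreconnected_cell120_diff_base.image _ (T.continuous_colouredCell c _).continuousOn)

theorem iUnion_sheetPart : ⋃ u, ⋃ i, sheetPart c u i = {n | 0 < T.colouredHeight c n} := by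
  ext n
  simp only [Set.mem_iUnion, Set.mem_ofPred_eq]
  constructor
  · rintro ⟨u, i, ⟨⟨m, s⟩, ⟨-, hs⟩, rfl⟩ | ⟨x, hx, rfl⟩⟩
    · obtain rfl : s = 1 / 20 := hs
      rw [T.colouredHeight_collarMap c u (by norm_num)]
      norm_num
    · exact hx
  · obtain ⟨⟨b, i, u⟩, x, rfl⟩ := T.colouredCell_surjective c n
    intro h
    refine ⟨u, i, Or.inr ⟨x, ?_⟩⟩
    cases b
    · have h1 : 0 < -height x.1 := h
      have h2 := height_nonneg x.2
      linarith
    · exact ⟨h, rfl⟩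

/-- Every colour is used by a facet of the copy `true` of `W'`, across which the sheets of `N` are
glued. -/
theorem sheet_inter_nonempty (hc : T.IsColouring c) (hsymm : T.IsSymmetric c)
    (u : Fin k → ZMod 2) (j : Fin k) :
    ((⋃ i, sheetPart c u i) ∩ ⋃ i, sheetPart c (u + Pi.single j 1) i).Nonempty := by
  obtain ⟨F, hF⟩ : ∃ F : T.HalfFacet, c (true, F) = j := by
    obtain ⟨⟨b, F⟩, hF⟩ := hc.1 j
    cases b
    · exact ⟨F, (congrFun hsymm (false, F)).trans hF⟩
    · exact ⟨F, hF⟩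
  obtain ⟨⟨i, v⟩, rfl⟩ := Quot.exists_rep F
  have hx := faceCentre_mem_cellFacet v.1.2
  let x : cell120 := ⟨_, hx.1⟩
  have hpos : 0 < height x.1 := by
    have := height_of_mem_free_facet v.1.2 v.2 hx
    change 0 < height (faceCentre _ _)
    linarith
  have hglue : T.colouredCell c (true, i, u + Pi.single j 1) x = T.colouredCell c (true, i, u) x :=
    Quot.sound (ColourRel.glue (true, Quot.mk _ (i, v)) _ _ _ ⟨(i, v), x, rfl, hx, rfl⟩
      (by rw [hF, add_sub_cancel_left]))
  exact ⟨T.colouredCell c (true, i, u) x, Set.mem_iUnion.2 ⟨i, Or.inr ⟨x, hpos, rfl⟩⟩,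
    Set.mem_iUnion.2 ⟨i, Or.inr ⟨x, hpos, hglue⟩⟩⟩

theorem isConnected_pos (hconn : ConnectedSpace T.Space) (hc : T.IsColouring c)
    (hsymm : T.IsSymmetric c) : IsConnected {n | 0 < T.colouredHeight c n} := by
  constructor
  · obtain ⟨m⟩ := hconn.toNonempty
    refine ⟨T.collarMap c 0 (m, 1 / 20), ?_⟩
    rw [Set.mem_ofPred_eq, T.colouredHeight_collarMap c 0 (by norm_num)]
    norm_num
  · rw [← iUnion_sheetPart c]
    refine IsPreconnected.iUnion_of_reflTransGen (isPreconnected_sheet c hconn) fun u v => ?_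
    -- Any two elements of `ℤ₂ᵏ` are connected by adding basis vectors.
    have h : ∀ s : Finset (Fin k), Relation.ReflTransGen
        (fun u v => ((⋃ i, sheetPart c u i) ∩ ⋃ i, sheetPart c v i).Nonempty) u
        (u + ∑ j ∈ s, Pi.single j ((v - u) j)) := by
      intro s
      induction s using Finset.induction_on with
      | empty => simpa using Relation.ReflTransGen.refl
      | insert j s hj ih =>
        rw [Finset.sum_insert hj, add_comm (Pi.single _ _), ← add_assoc]
        have hcases : ∀ a : ZMod 2, a = 0 ∨ a = 1 := by decide
        rcases hcases ((v - u) j) with h | h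
        · rw [h, Pi.single_zero, add_zero]
          exact ih
        · rw [h]
          exact ih.tail (sheet_inter_nonempty c hc hsymm _ j)
    have := h Finset.univ
    rwa [Finset.univ_sum_single, add_sub_cancel] at this

/-! ### The isometry that exchanges the two sides -/

theorem mirrorRel_swap {p q : Bool × T.Half} (h : T.MirrorRel p q) :
    T.MirrorRel (!p.1, p.2) (!q.1, q.2) := by
  obtain ⟨b, b', p, hp⟩ := h
  exact .glue _ _ p hp

/-- The involution of `W` that exchanges the two copies of `W'`. -/
def mirrorSwap : T.Mirror → T.Mirror := Quot.map _ fun _ _ h => mirrorRel_swap h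

theorem mirrorSwap_mem_facetSet {F : T.Facet} {p : T.Mirror} (hp : p ∈ T.facetSet F) :
    mirrorSwap p ∈ T.facetSet (T.facetSwap F) := by
  obtain ⟨f, x, hf, hx, rfl⟩ := hp
  exact ⟨f, x, hf, hx, rfl⟩

theorem colourRel_swap (hsymm : T.IsSymmetric c) {p q : T.Mirror × (Fin k → ZMod 2)}
    (h : T.ColourRel c p q) : T.ColourRel c (mirrorSwap p.1, p.2) (mirrorSwap q.1, q.2) := by
  obtain ⟨F, p, u, v, hp, huv⟩ := h
  refine .glue (T.facetSwap F) _ u v (mirrorSwap_mem_facetSet hp) ?_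
  rw [huv]
  exact congrArg (fun j => Pi.single j 1) (congrFun hsymm F).symm

/-- The involution of `N` induced by a symmetric colouring. -/
def colouredSwap (hsymm : T.IsSymmetric c) : T.Coloured c → T.Coloured c :=
  Quot.map _ fun _ _ h => colourRel_swap c hsymm h

theorem colouredSwap_cell (hsymm : T.IsSymmetric c) (j : Bool × ι × (Fin k → ZMod 2))
    (x : cell120) :
    colouredSwap c hsymm (T.colouredCell c j x) = T.colouredCell c (!j.1, j.2) x := rfl

theorem colouredSwap_swap (hsymm : T.IsSymmetric c) (n : T.Coloured c) :
    colouredSwap c hsymm (colouredSwap c hsymm n) = n := by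
  obtain ⟨⟨b, i, u⟩, x, rfl⟩ := T.colouredCell_surjective c n
  rw [colouredSwap_cell, colouredSwap_cell, Bool.not_not]

theorem colouredHeight_swap (hsymm : T.IsSymmetric c) (n : T.Coloured c) :
    T.colouredHeight c (colouredSwap c hsymm n) = -T.colouredHeight c n := by
  obtain ⟨⟨b, i, u⟩, x, rfl⟩ := T.colouredCell_surjective c n
  rw [colouredSwap_cell, colouredHeight_cell, colouredHeight_cell]
  cases b <;> simp

theorem continuous_colouredSwap (hsymm : T.IsSymmetric c) : Continuous (colouredSwap c hsymm) :=
  continuous_of_colouredCell fun j => T.continuous_colouredCell c (!j.1, j.2)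

/-- The involution of `N` as a homeomorphism. -/
def colouredSwapHomeomorph (hsymm : T.IsSymmetric c) : T.Coloured c ≃ₜ T.Coloured c where
  toFun := colouredSwap c hsymm
  invFun := colouredSwap c hsymm
  left_inv := colouredSwap_swap c hsymm
  right_inv := colouredSwap_swap c hsymm
  continuous_toFun := continuous_colouredSwap c hsymm
  continuous_invFun := continuous_colouredSwap c hsymm

theorem isPathLength_swap (hsymm : T.IsSymmetric c) {Y Z : Set (T.Coloured c)}
    (hYZ : ∀ n ∈ Y, colouredSwap c hsymm n ∈ Z) {p q : T.Coloured c} {ℓ : ℝ}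
    (h : IsPathLength (T.colouredCell c) Y p q ℓ) :
    IsPathLength (T.colouredCell c) Z (colouredSwap c hsymm p) (colouredSwap c hsymm q) ℓ := by
  induction h with
  | nil p hp => exact .nil _ (hYZ p hp)
  | cons j x y q ℓ hseg _ ih =>
    exact .cons (!j.1, j.2) x y _ ℓ (fun z hz => hYZ _ (hseg z hz)) ih

theorem areIsometric_sides (hsymm : T.IsSymmetric c) :
    AreIsometric (T.colouredCell c) {n | 0 < T.colouredHeight c n}
      {n | T.colouredHeight c n < 0} := by
  refine ⟨(colouredSwapHomeomorph c hsymm).subtype fun n => ?_, fun p q => ?_⟩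
  · change 0 < T.colouredHeight c n ↔ T.colouredHeight c (colouredSwap c hsymm n) < 0
    rw [colouredHeight_swap, neg_lt_zero]
  · refine iInf_congr fun ℓ => iInf_congr_Prop ⟨fun h => ?_, fun h => ?_⟩ fun _ => rfl
    · have := isPathLength_swap c hsymm (Z := {n | 0 < T.colouredHeight c n}) (fun n hn => by
        rw [Set.mem_ofPred_eq, colouredHeight_swap]
        exact neg_pos.2 hn) h
      change IsPathLength _ _ (colouredSwap c hsymm (colouredSwap c hsymm p.1))
        (colouredSwap c hsymm (colouredSwap c hsymm q.1)) ℓ at this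
      rwa [colouredSwap_swap, colouredSwap_swap] at this
    · exact isPathLength_swap c hsymm (fun n hn => by
        rw [Set.mem_ofPred_eq, colouredHeight_swap]
        exact neg_lt_zero.2 hn) h

theorem isConnected_neg (hconn : ConnectedSpace T.Space) (hc : T.IsColouring c)
    (hsymm : T.IsSymmetric c) : IsConnected {n | T.colouredHeight c n < 0} := by
  have h := (isConnected_pos c hconn hc hsymm).image _
    (continuous_colouredSwap c hsymm).continuousOn
  convert h using 1
  ext n
  constructor
  · intro hn
    refine ⟨colouredSwap c hsymm n, ?_, colouredSwap_swap c hsymm n⟩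
    rw [Set.mem_ofPred_eq, colouredHeight_swap]
    exact neg_pos.2 hn
  · rintro ⟨m, hm, rfl⟩
    rw [Set.mem_ofPred_eq, colouredHeight_swap]
    exact neg_lt_zero.2 hm

end DodecahedralGluing

end

end Dodecahedral

theorem mainTheorem5 {ι : Type*} [Finite ι] (T : Dodecahedral.DodecahedralGluing ι)
    (hM : Dodecahedral.IsHyperbolicManifold T.cell) (hconn : ConnectedSpace T.Space)
    {k : ℕ} (c : T.Facet → Fin k) (hc : T.IsColouring c) (hsymm : T.IsSymmetric c) :
    ∃ f : T.Space × (Fin k → ZMod 2) → T.Coloured c,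
      (∀ (i : ι) (x : Dodecahedral.dodecahedron) (u : Fin k → ZMod 2) (b : Bool),
        f (T.cell i x, u) = T.colouredCell c (b, i, u) (Dodecahedral.baseInclusion x)) ∧
      Dodecahedral.IsTotallyGeodesicEmbedding (T.copiesCell k) (T.colouredCell c) f ∧
      ∃ Nplus Nminus : Set (T.Coloured c),
        IsOpen Nplus ∧ IsOpen Nminus ∧ IsConnected Nplus ∧ IsConnected Nminus ∧
        Disjoint Nplus Nminus ∧ Nplus ∪ Nminus = (Set.range f)ᶜ ∧
        Dodecahedral.AreIsometric (T.colouredCell c) Nplus Nminus := by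
  have hη := T.continuous_colouredHeight c
  refine ⟨T.baseMap c, T.baseMap_cell c,
    Dodecahedral.DodecahedralGluing.isTotallyGeodesicEmbedding_baseMap c hM,
    {n | 0 < T.colouredHeight c n}, {n | T.colouredHeight c n < 0},
    isOpen_lt continuous_const hη, isOpen_lt hη continuous_const,
    Dodecahedral.DodecahedralGluing.isConnected_pos c hconn hc hsymm,
    Dodecahedral.DodecahedralGluing.isConnected_neg c hconn hc hsymm,
    Set.disjoint_left.2 fun n (h1 : 0 < T.colouredHeight c n) (h2 : T.colouredHeight c n < 0) =>
      lt_asymm h1 h2, ?_,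
    Dodecahedral.DodecahedralGluing.areIsometric_sides c hsymm⟩
  ext n
  rw [Set.mem_compl_iff, T.mem_range_baseMap_iff c, ← ne_eq, ne_comm, ne_iff_lt_or_gt]
  rfl
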